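/- Let $N\ge 2$ and $2<\theta<\frac{2N}{N-1}$. Let $f\in C^1(\mathbb{R})$ satisfy $f\ge 0$ on $[0,\infty)$, $f(t)=0$ for $t<0$, $\lim_{t\to 0}|f(t)|/t=0$, $\lim_{t\to\infty}f(t)/t^{\theta-1}=0$, and let $f(t)/t$ be nondecreasing on $(0,\infty)$; put $F(t)=\int_0^t f(s)\,ds$. Let $m>0$ and let $V:\mathbb{R}^N\to\mathbb{R}$ be continuous, with $V+V_0\ge 0$ for some $V_0\in(0,m)$, $\lim_{|y|\to\infty}V(y)=V_\infty>0$, $V\le V_\infty$ and $V\not\equiv V_\infty$. Let $W=W_1+W_2$ be (up to null sets) nonnegative and radial on $\mathbb{R}^N$, where $W_1\in L^r(\mathbb{R}^N)$ for some real $r>\frac{N}{N(2-\theta)+\theta}$ and $W_2\in L^\infty(\mathbb{R}^N)$. Write $\mathbb{R}^{N+1}_+=\{(x,y):x>0,\ y\in\mathbb{R}^N\}$, let $H^1(\mathbb{R}^{N+1}_+)$ be the space of real $u\in L^2(\mathbb{R}^{N+1}_+)$ with weak gradient $\nabla u\in L^2(\mathbb{R}^{N+1}_+)$, and let $\gamma$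 be its trace operator on $\{x=0\}=\mathbb{R}^N$. Let $v\in H^1(\mathbb{R}^{N+1}_+)$ be a weak solution of $$\begin{cases}-\Delta v+m^2v=0&\text{in }\mathbb{R}^{N+1}_+,\\ -\dfrac{\partial v}{\partial x}(0,y)=-V(y)v(0,y)+\big(W*F(v(0,\cdot))\big)(y)\,f(v(0,y))&\text{on }\mathbb{R}^N,\end{cases}$$ that is, for every $\varphi\in H^1(\mathbb{R}^{N+1}_+)$, $$\iint_{\mathbb{R}^{N+1}_+}\big(\nabla v\cdot\nabla\varphi+m^2v\varphi\big)\,dx\,dy+\int_{\mathbb{R}^N}V\,\gamma(v)\gamma(\varphi)\,dy-\int_{\mathbb{R}^N}\big(W*F(\gamma(v))\big)f(\gamma(v))\,\gamma(\varphi)\,dy=0.$$ Then $\gamma(v)\in L^p(\mathbb{R}^N)$ for every $p\in[2,\infty]$, and $v\in L^\infty(\mathbb{R}^{N+1}_+)$. -/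

import Mathlib

open MeasureTheory Filter Topology Set
open scoped ENNReal ContDiff Convolution

namespace Hartree

/-- The boundary space `ℝ^N`, with its Euclidean norm. -/
abbrev Bdry (N : ℕ) : Type := EuclideanSpace ℝ (Fin N)

/-- The ambient space `ℝ^{N+1}`, with points `z = (x, y)`, `x ∈ ℝ`, `y ∈ ℝ^N`.  It carries the
product (Lebesgue) measure; its norm is used only through the topology, the notion of
differentiability and membership in `L²`. -/
abbrev Amb (N : ℕ) : Type := ℝ × Bdry N

/-- The open half-space `ℝ^{N+1}_+ = {(x, y) : x > 0}`. -/
def halfSpace (N : ℕ) : Set (Amb N) := {z | 0 < z.1}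

/-- Lebesgue measure on the half-space. -/
noncomputable def halfMeasure (N : ℕ) : Measure (Amb N) := volume.restrict (halfSpace N)

/-- The Euclidean scalar product of `ℝ^{N+1}`. -/
noncomputable def dot {N : ℕ} (a b : Amb N) : ℝ := a.1 * b.1 + inner ℝ a.2 b.2

/-- `G` is a square integrable weak gradient of `v` in the open half-space:
`∫ v ∂_e φ = - ∫ (G · e) φ` for every `φ ∈ C_c^∞(ℝ^{N+1}_+)` and every direction `e`. -/
def IsWeakGrad {N : ℕ} (v : Amb N → ℝ) (G : Amb N → Amb N) : Prop :=
  MemLp G 2 (halfMeasure N) ∧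
  ∀ φ : Amb N → ℝ, ContDiff ℝ ∞ φ → HasCompactSupport φ → tsupport φ ⊆ halfSpace N →
    ∀ e : Amb N,
      ∫ z, v z * fderiv ℝ φ z e ∂(halfMeasure N) = -∫ z, dot (G z) e * φ z ∂(halfMeasure N)

/-- `v ∈ H¹(ℝ^{N+1}_+)`: `v` is in `L²` and has a weak gradient in `L²`. -/
def MemH1 {N : ℕ} (v : Amb N → ℝ) : Prop :=
  MemLp v 2 (halfMeasure N) ∧ ∃ G : Amb N → Amb N, IsWeakGrad v G

open Classical in
/-- The weak gradient `∇v` of `v ∈ H¹(ℝ^{N+1}_+)` (unique up to null sets). -/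
noncomputable def weakGrad {N : ℕ} (v : Amb N → ℝ) : Amb N → Amb N :=
  if h : ∃ G : Amb N → Amb N, IsWeakGrad v G then h.choose else 0

/-- `u ∈ L²(ℝ^N)` is the trace of `v` on `{x = 0}`: the pair `(v, u)` is a limit in
`H¹(ℝ^{N+1}_+) × L²(ℝ^N)` of pairs `(φ, φ(0, ·))` with `φ ∈ C_c^∞(ℝ^{N+1})`. -/
def IsTrace {N : ℕ} (v : Amb N → ℝ) (u : Bdry N → ℝ) : Prop :=
  MemLp u 2 volume ∧
  ∃ φ : ℕ → Amb N → ℝ,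
    (∀ n, ContDiff ℝ ∞ (φ n) ∧ HasCompactSupport (φ n)) ∧
    Tendsto (fun n => eLpNorm (fun z => φ n z - v z) 2 (halfMeasure N)) atTop (𝓝 0) ∧
    (∀ e : Amb N,
      Tendsto (fun n => eLpNorm (fun z => fderiv ℝ (φ n) z e - dot (weakGrad v z) e) 2
        (halfMeasure N)) atTop (𝓝 0)) ∧
    Tendsto (fun n => eLpNorm (fun y => φ n (0, y) - u y) 2 volume) atTop (𝓝 0)

open Classical in
/-- The trace operator `γ`.  By the trace theorem each `v ∈ H¹(ℝ^{N+1}_+)` has a trace, unique up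
to null sets, so the default value is never used on `H¹(ℝ^{N+1}_+)`. -/
noncomputable def trace {N : ℕ} (v : Amb N → ℝ) : Bdry N → ℝ :=
  if h : ∃ u : Bdry N → ℝ, IsTrace v u then h.choose else 0

/-- The primitive `F(t) = ∫₀ᵗ f(s) ds`. -/
noncomputable def prim (f : ℝ → ℝ) (t : ℝ) : ℝ := ∫ s in (0 : ℝ)..t, f s

/-- The nonlocal coefficient `W * F(u)` on `ℝ^N`. -/
noncomputable def hartree {N : ℕ} (W : Bdry N → ℝ) (f : ℝ → ℝ) (u : Bdry N → ℝ) : Bdry N → ℝ :=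
  W ⋆[ContinuousLinearMap.mul ℝ ℝ, volume] (fun y => prim f (u y))

/-- `v` is a weak solution in `H¹(ℝ^{N+1}_+)` of `-Δv + m²v = 0` in `ℝ^{N+1}_+`,
`-∂v/∂x(0, y) = -V(y) v(0, y) + (W * F(v(0, ·)))(y) f(v(0, y))` on `ℝ^N`. -/
def IsWeakSolution {N : ℕ} (m : ℝ) (V W : Bdry N → ℝ) (f : ℝ → ℝ) (v : Amb N → ℝ) : Prop :=
  MemH1 v ∧ ∀ φ : Amb N → ℝ, MemH1 φ →
    (∫ z, (dot (weakGrad v z) (weakGrad φ z) + m ^ 2 * v z * φ z) ∂(halfMeasure N))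
      + (∫ y, V y * trace v y * trace φ y)
      - (∫ y, hartree W f (trace v) y * f (trace v y) * trace φ y) = 0

end Hartree

namespace Hartree
open scoped NNReal

lemma halfMeasure_eq_prod (N : ℕ) :
    halfMeasure N = ((volume : Measure ℝ).restrict (Ioi 0)).prod (volume : Measure (Bdry N)) := by
  have h : halfSpace N = Ioi (0 : ℝ) ×ˢ (univ : Set (Bdry N)) := by
    ext z; simp [halfSpace]
  rw [halfMeasure, h, Measure.volume_eq_prod, ← Measure.prod_restrict, Measure.restrict_univ]

lemma measurableSet_halfSpace (N : ℕ) : MeasurableSet (halfSpace N) :=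
  measurableSet_lt measurable_const measurable_fst

lemma isOpen_halfSpace (N : ℕ) : IsOpen (halfSpace N) :=
  isOpen_lt continuous_const continuous_fst

lemma lintegral_comp_abs (g : ℝ → ℝ≥0∞) :
    ∫⁻ x, g |x| = 2 * ∫⁻ x in Ioi 0, g x := by
  rw [← lintegral_add_compl _ (measurableSet_Ioi (a := (0 : ℝ))), compl_Ioi, two_mul]
  congr 1
  · exact setLIntegral_congr_fun measurableSet_Ioi fun x hx => by rw [abs_of_pos hx]
  · rw [setLIntegral_congr (Iio_ae_eq_Iic (a := (0 : ℝ))).symm]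
    have := (Measure.measurePreserving_neg (volume : Measure ℝ)).setLIntegral_comp_preimage_emb
      (MeasurableEquiv.neg ℝ).measurableEmbedding g (Ioi 0)
    simp only [neg_preimage, neg_Ioi, neg_zero] at this
    rw [← this]
    exact setLIntegral_congr_fun measurableSet_Iio fun x hx => by rw [abs_of_neg hx]

/-- The even reflection of a function on the half-space has twice its integral. -/
lemma lintegral_comp_abs_fst {N : ℕ} {G : Amb N → ℝ≥0∞} (hG : Measurable G) :
    ∫⁻ z : Amb N, G (|z.1|, z.2) = 2 * ∫⁻ z, G z ∂(halfMeasure N) := by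
  rw [halfMeasure_eq_prod, lintegral_prod _ hG.aemeasurable, Measure.volume_eq_prod,
    lintegral_prod _ (by fun_prop), lintegral_comp_abs (fun x => ∫⁻ y, G (x, y))]

/-- A smooth approximation of the reflection `(x, y) ↦ (|x|, y)`. -/
noncomputable def softAbs (N : ℕ) (ε : ℝ) (z : Amb N) : Amb N := (√(z.1 ^ 2 + ε ^ 2), z.2)

lemma contDiff_softAbs (N : ℕ) {ε : ℝ} (hε : 0 < ε) : ContDiff ℝ ∞ (softAbs N ε) := by
  refine ContDiff.prodMk (ContDiff.sqrt (by fun_prop) fun z => ?_) contDiff_snd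
  positivity

lemma lipschitzWith_softAbs (N : ℕ) {ε : ℝ} (hε : 0 < ε) : LipschitzWith 1 (softAbs N ε) := by
  have key : ∀ a b : ℝ, √(a ^ 2 + ε ^ 2) ≤ √(b ^ 2 + ε ^ 2) + |a - b| := fun a b => by
    have hb : |b| ≤ √(b ^ 2 + ε ^ 2) := by
      rw [← Real.sqrt_sq_eq_abs]; exact Real.sqrt_le_sqrt (by nlinarith [sq_nonneg ε])
    have h2 := Real.sq_sqrt (show 0 ≤ b ^ 2 + ε ^ 2 by positivity)
    refine Real.sqrt_le_iff.2 ⟨by positivity, ?_⟩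
    have h3 : b * (a - b) ≤ √(b ^ 2 + ε ^ 2) * |a - b| :=
      (le_abs_self _).trans (by rw [abs_mul]; gcongr)
    nlinarith [sq_abs (a - b)]
  refine LipschitzWith.of_dist_le_mul fun z w => ?_
  rw [NNReal.coe_one, one_mul, Prod.dist_eq, Prod.dist_eq]
  refine max_le_max ?_ le_rfl
  simp only [softAbs, Real.dist_eq]
  refine abs_sub_le_iff.2 ⟨?_, ?_⟩
  · linarith [key z.1 w.1]
  · linarith [key w.1 z.1, abs_sub_comm z.1 w.1]

lemma norm_le_norm_softAbs {N : ℕ} (ε : ℝ) (z : Amb N) : ‖z‖ ≤ ‖softAbs N ε z‖ := by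
  rw [Prod.norm_def, Prod.norm_def]
  refine max_le_max ?_ le_rfl
  simp only [softAbs, Real.norm_eq_abs, abs_of_nonneg (Real.sqrt_nonneg _)]
  rw [← Real.sqrt_sq_eq_abs]; exact Real.sqrt_le_sqrt (by nlinarith [sq_nonneg ε])

lemma tendsto_softAbs {N : ℕ} (z : Amb N) :
    Tendsto (fun n : ℕ => softAbs N (1 / ((n : ℝ) + 1)) z) atTop (𝓝 (|z.1|, z.2)) := by
  have h : Continuous fun ε : ℝ => softAbs N ε z := by unfold softAbs; fun_prop
  have := (h.tendsto 0).comp tendsto_one_div_add_atTop_nhds_zero_nat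
  simpa [softAbs, Real.sqrt_sq_eq_abs, Function.comp_def] using this

instance (N : ℕ) : (volume : Measure (Amb N)).IsAddHaarMeasure :=
  Measure.prod.instIsAddHaarMeasure (volume : Measure ℝ) (volume : Measure (Bdry N))

lemma finrank_amb (N : ℕ) : Module.finrank ℝ (Amb N) = N + 1 := by
  simp [add_comm]

/-- Sobolev inequality on the half-space, for smooth functions up to the boundary. -/
lemma exists_sobolev_half (N : ℕ) {p : ℝ≥0}
    (hp : (p : ℝ)⁻¹ = (2 : ℝ)⁻¹ - ((N : ℝ) + 1)⁻¹) :
    ∃ C : ℝ≥0, ∀ φ : Amb N → ℝ, ContDiff ℝ ∞ φ → HasCompactSupport φ →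
      eLpNorm φ p (halfMeasure N) ≤ C * eLpNorm (fderiv ℝ φ) 2 (halfMeasure N) := by
  set C := SNormLESNormFDerivOfEqConst ℝ (volume : Measure (Amb N)) (2 : ℝ≥0) with hC
  refine ⟨C * NNReal.sqrt 2, fun φ hφ hφc => ?_⟩
  obtain ⟨R, hR⟩ := hφc.isCompact.isBounded.subset_closedBall (0 : Amb N)
  have hφ1 : Continuous (fderiv ℝ φ) := hφ.continuous_fderiv (by simp)
  obtain ⟨M, hM⟩ := hφ1.bounded_above_of_compact_support (hφc.fderiv (𝕜 := ℝ))
  set ε : ℕ → ℝ := fun n => 1 / ((n : ℝ) + 1) with hεdef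
  have hε : ∀ n, 0 < ε n := fun n => by simp only [hεdef]; positivity
  set E : ℕ → Amb N → ℝ := fun n z => φ (softAbs N (ε n) z) with hE
  have hEc : ∀ n, ContDiff ℝ ∞ (E n) := fun n => hφ.comp (contDiff_softAbs N (hε n))
  have hout : ∀ n z, R < ‖z‖ → softAbs N (ε n) z ∉ tsupport φ := fun n z hz h => by
    have := mem_closedBall_zero_iff.1 (hR h)
    linarith [norm_le_norm_softAbs (ε n) z]
  have hEs : ∀ n, HasCompactSupport (E n) := fun n =>
    HasCompactSupport.intro (isCompact_closedBall (0 : Amb N) R) fun z hz => by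
      exact image_eq_zero_of_notMem_tsupport (f := φ) (hout n z (by simpa using hz))
  have hder : ∀ n z, ‖fderiv ℝ (E n) z‖ₑ ≤ ‖fderiv ℝ φ (softAbs N (ε n) z)‖ₑ := fun n z => by
    have h1 : fderiv ℝ (E n) z = (fderiv ℝ φ (softAbs N (ε n) z)).comp
        (fderiv ℝ (softAbs N (ε n)) z) :=
      fderiv_comp z (hφ.differentiable (by simp) _)
        ((contDiff_softAbs N (hε n)).differentiable (by simp) _)
    have h2 : ‖fderiv ℝ (softAbs N (ε n)) z‖ ≤ 1 := by
      simpa using norm_fderiv_le_of_lipschitz ℝ (x₀ := z) (lipschitzWith_softAbs N (hε n))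
    rw [← ofReal_norm, ← ofReal_norm, h1]
    refine ENNReal.ofReal_le_ofReal ((ContinuousLinearMap.opNorm_comp_le _ _).trans ?_)
    exact mul_le_of_le_one_right (norm_nonneg _) h2
  have hsob : ∀ n, eLpNorm (E n) p (halfMeasure N) ≤
      C * (∫⁻ z : Amb N, ‖fderiv ℝ φ (softAbs N (ε n) z)‖ₑ ^ (2 : ℝ)) ^ (1 / (2 : ℝ)) := fun n => by
    have h1 := eLpNorm_le_eLpNorm_fderiv_of_eq (F := ℝ) (volume : Measure (Amb N))
      ((hEc n).of_le (by simp)) (hEs n) (p := 2) (p' := p) (by norm_num)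
      (by rw [finrank_amb]; omega) (by rw [finrank_amb, hp]; push_cast; ring)
    refine (eLpNorm_mono_measure _ Measure.restrict_le_self).trans (h1.trans ?_)
    gcongr
    rw [ENNReal.coe_ofNat, eLpNorm_eq_lintegral_rpow_enorm_toReal (by simp) (by simp)]
    simp only [ENNReal.toReal_ofNat]
    gcongr with z
    exact hder n z
  have hlim : Tendsto (fun n => ∫⁻ z : Amb N, ‖fderiv ℝ φ (softAbs N (ε n) z)‖ₑ ^ (2 : ℝ)) atTop
      (𝓝 (∫⁻ z : Amb N, ‖fderiv ℝ φ (|z.1|, z.2)‖ₑ ^ (2 : ℝ))) := by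
    refine tendsto_lintegral_of_dominated_convergence
      ((Metric.closedBall (0 : Amb N) R).indicator fun _ => ENNReal.ofReal M ^ (2 : ℝ))
      (fun n => ?_) (fun n => Eventually.of_forall fun z => ?_) ?_
      (Eventually.of_forall fun z => ?_)
    · exact (hφ1.comp (contDiff_softAbs N (hε n)).continuous).enorm.measurable.pow_const _
    · by_cases hz : z ∈ Metric.closedBall (0 : Amb N) R
      · beta_reduce
        rw [indicator_of_mem hz, ← ofReal_norm]
        exact ENNReal.rpow_le_rpow (ENNReal.ofReal_le_ofReal (hM _)) (by norm_num)
      · have : fderiv ℝ φ (softAbs N (ε n) z) = 0 := by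
          refine image_eq_zero_of_notMem_tsupport fun h => hout n z (by simpa using hz) ?_
          exact tsupport_fderiv_subset ℝ h
        beta_reduce
        rw [indicator_of_notMem hz, this, ← ofReal_norm, norm_zero]; simp
    · rw [lintegral_indicator measurableSet_closedBall, setLIntegral_const]
      exact ENNReal.mul_ne_top (by simp) measure_closedBall_lt_top.ne
    · exact (ENNReal.continuous_rpow_const.tendsto _).comp
        ((hφ1.enorm.tendsto _).comp (tendsto_softAbs z))
  have hpt : ∀ᵐ z ∂(halfMeasure N), Tendsto (fun n => E n z) atTop (𝓝 (φ z)) := by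
    filter_upwards [ae_restrict_mem (measurableSet_halfSpace N)] with z hz
    have := (hφ.continuous.tendsto _).comp (tendsto_softAbs z)
    rwa [abs_of_pos hz] at this
  refine (Lp.eLpNorm_lim_le_liminf_eLpNorm
    (fun n => (hEc n).continuous.aestronglyMeasurable) φ hpt).trans ?_
  have h2 : Tendsto (fun n => C * (∫⁻ z : Amb N, ‖fderiv ℝ φ (softAbs N (ε n) z)‖ₑ ^ (2 : ℝ))
      ^ (1 / (2 : ℝ))) atTop
      (𝓝 (C * (∫⁻ z : Amb N, ‖fderiv ℝ φ (|z.1|, z.2)‖ₑ ^ (2 : ℝ)) ^ (1 / (2 : ℝ)))) :=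
    ENNReal.Tendsto.const_mul ((ENNReal.continuous_rpow_const.tendsto _).comp hlim)
      (Or.inr ENNReal.coe_ne_top)
  refine (liminf_le_liminf (Eventually.of_forall hsob)).trans ?_
  rw [h2.liminf_eq, lintegral_comp_abs_fst (G := fun z => ‖fderiv ℝ φ z‖ₑ ^ (2 : ℝ))
    (hφ1.enorm.measurable.pow_const _), ENNReal.mul_rpow_of_nonneg _ _ (by norm_num),
    eLpNorm_eq_lintegral_rpow_enorm_toReal (by simp) (by simp), ENNReal.toReal_ofNat, ← mul_assoc,
    ENNReal.coe_mul]
  gcongr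
  rw [NNReal.sqrt_eq_rpow, ENNReal.coe_rpow_of_nonneg _ (by norm_num)]
  simp

/-- The fundamental theorem of calculus for `|φ|^s` along `x ↦ (x, y)`, integrated in `y`. -/
lemma lintegral_trace_rpow_le {N : ℕ} {s : ℝ≥0} (hs1 : 1 < s) {φ : Amb N → ℝ}
    (hφ : ContDiff ℝ ∞ φ) (hφc : HasCompactSupport φ) :
    ∫⁻ y, ‖φ ((0 : ℝ), y)‖ₑ ^ (s : ℝ) ≤
      s * ((∫⁻ z, (‖φ z‖ₑ ^ ((s : ℝ) - 1)) ^ (2 : ℝ) ∂(halfMeasure N)) ^ (1 / (2 : ℝ)) *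
        eLpNorm (fderiv ℝ φ) 2 (halfMeasure N)) := by
  have hs2 : (1 : ℝ) < s := by exact_mod_cast hs1
  have hφ1 : Continuous (fderiv ℝ φ) := hφ.continuous_fderiv (by simp)
  have hline : ∀ y : Bdry N, ‖φ (0, y)‖ₑ ^ (s : ℝ) ≤
      ∫⁻ x in Ioi (0 : ℝ), s * ‖φ (x, y)‖ₑ ^ ((s : ℝ) - 1) * ‖fderiv ℝ φ (x, y)‖ₑ := fun y => by
    have hψ : ContDiff ℝ ∞ fun x : ℝ => φ (x, y) := hφ.comp (by fun_prop)
    have hψc : HasCompactSupport fun x : ℝ => φ (x, y) := by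
      obtain ⟨R, hR⟩ := hφc.isCompact.isBounded.subset_closedBall (0 : Amb N)
      refine HasCompactSupport.intro (isCompact_closedBall (0 : ℝ) R) fun x hx => ?_
      refine image_eq_zero_of_notMem_tsupport fun h => hx ?_
      have := mem_closedBall_zero_iff.1 (hR h)
      rw [Prod.norm_def] at this
      exact mem_closedBall_zero_iff.2 ((le_max_left _ _).trans this)
    have hg : ContDiff ℝ 1 fun x : ℝ => ‖φ (x, y)‖ ^ (s : ℝ) :=
      (contDiff_norm_rpow (E := ℝ) (by exact_mod_cast hs1)).comp (hψ.of_le (by simp))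
    have hgc : HasCompactSupport fun x : ℝ => ‖φ (x, y)‖ ^ (s : ℝ) :=
      hψc.comp_left (g := fun t : ℝ => ‖t‖ ^ (s : ℝ)) (by
        simp only [norm_zero]; exact Real.zero_rpow (by linarith))
    have h1 := hgc.integral_Ioi_deriv_eq hg 0
    have h2 : ‖φ (0, y)‖ₑ ^ (s : ℝ) =
        ‖∫ x in Ioi (0 : ℝ), deriv (fun x : ℝ => ‖φ (x, y)‖ ^ (s : ℝ)) x‖ₑ := by
      rw [h1, enorm_neg, ← ofReal_norm (φ (0, y)), ← ofReal_norm (‖φ (0, y)‖ ^ (s : ℝ)),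
        Real.norm_of_nonneg (Real.rpow_nonneg (norm_nonneg (φ (0, y))) (s : ℝ)),
        ENNReal.ofReal_rpow_of_nonneg (norm_nonneg _) (by linarith)]
    rw [h2]
    clear h1 h2
    refine (enorm_integral_le_lintegral_enorm _).trans (lintegral_mono fun x => ?_)
    have h3 := enorm_fderiv_norm_rpow_le (F := ℝ) (hψ.differentiable (by simp)) (x := x) hs1
    have h5 : ‖deriv (fun x : ℝ => ‖φ (x, y)‖ ^ (s : ℝ)) x‖ₑ =
        ‖fderiv ℝ (fun x : ℝ => ‖φ (x, y)‖ ^ (s : ℝ)) x‖ₑ := by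
      rw [← ofReal_norm, ← ofReal_norm, norm_deriv_eq_norm_fderiv]
    refine h5.trans_le (h3.trans ?_)
    gcongr
    have h4 : fderiv ℝ (fun x : ℝ => φ (x, y)) x =
        (fderiv ℝ φ (x, y)).comp (ContinuousLinearMap.inl ℝ ℝ (Bdry N)) :=
      ((hφ.differentiable (by simp) (x, y)).hasFDerivAt.comp (f := fun t : ℝ => (t, y)) x
        (hasFDerivAt_prodMk_left x y)).fderiv
    rw [h4, ← ofReal_norm, ← ofReal_norm]
    refine ENNReal.ofReal_le_ofReal ((ContinuousLinearMap.opNorm_comp_le _ _).trans ?_)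
    exact mul_le_of_le_one_right (norm_nonneg _) (ContinuousLinearMap.norm_inl_le_one ℝ ℝ _)
  have hmeas : Measurable fun z : Amb N => (s : ℝ≥0∞) * ‖φ z‖ₑ ^ ((s : ℝ) - 1) * ‖fderiv ℝ φ z‖ₑ :=
    ((hφ.continuous.enorm.measurable.pow_const _).const_mul _).mul hφ1.enorm.measurable
  calc _ ≤ ∫⁻ y : Bdry N, ∫⁻ x in Ioi (0 : ℝ),
        s * ‖φ (x, y)‖ₑ ^ ((s : ℝ) - 1) * ‖fderiv ℝ φ (x, y)‖ₑ := lintegral_mono hline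
    _ = ∫⁻ z, s * ‖φ z‖ₑ ^ ((s : ℝ) - 1) * ‖fderiv ℝ φ z‖ₑ ∂(halfMeasure N) := by
        rw [halfMeasure_eq_prod, lintegral_prod_symm _ hmeas.aemeasurable]
    _ = s * ∫⁻ z, ((fun z => ‖φ z‖ₑ ^ ((s : ℝ) - 1)) * fun z => ‖fderiv ℝ φ z‖ₑ) z
          ∂(halfMeasure N) := by
        rw [← lintegral_const_mul' _ _ ENNReal.coe_ne_top]
        simp only [Pi.mul_apply, mul_assoc]
    _ ≤ s * ((∫⁻ z, (‖φ z‖ₑ ^ ((s : ℝ) - 1)) ^ (2 : ℝ) ∂(halfMeasure N)) ^ (1 / (2 : ℝ)) *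
          eLpNorm (fderiv ℝ φ) 2 (halfMeasure N)) := by
        gcongr
        rw [eLpNorm_eq_lintegral_rpow_enorm_toReal (by simp) (by simp), ENNReal.toReal_ofNat]
        exact ENNReal.lintegral_mul_le_Lp_mul_Lq _ Real.HolderConjugate.two_two
          (hφ.continuous.enorm.measurable.pow_const _).aemeasurable
          hφ1.enorm.measurable.aemeasurable

/-- Trace inequality `L^s(ℝ^N)`, `s = 2N/(N-1)`, for smooth functions. -/
lemma exists_trace_smooth (N : ℕ) (hN : 2 ≤ N) {s : ℝ≥0} (hs : (s : ℝ) = 2 * N / (N - 1)) :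
    ∃ C : ℝ≥0, ∀ φ : Amb N → ℝ, ContDiff ℝ ∞ φ → HasCompactSupport φ →
      eLpNorm (fun y => φ (0, y)) s volume ≤ C * eLpNorm (fderiv ℝ φ) 2 (halfMeasure N) := by
  have hN' : (2 : ℝ) ≤ N := by exact_mod_cast hN
  have hs2 : (2 : ℝ) < s := by rw [hs, lt_div_iff₀ (by linarith)]; linarith
  have hs1 : (1 : ℝ≥0) < s := by
    rw [← NNReal.coe_lt_coe, NNReal.coe_one]; linarith
  set p : ℝ≥0 := 2 * (s - 1) with hp
  have hpr : (p : ℝ) = 2 * (s - 1) := by rw [hp, NNReal.coe_mul, NNReal.coe_sub hs1.le]; rfl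
  obtain ⟨C, hC⟩ := exists_sobolev_half N (p := p) (by
    rw [hpr, hs]
    have : (N : ℝ) - 1 ≠ 0 := by linarith
    have : (N : ℝ) + 1 ≠ 0 := by linarith
    have h3 : 2 * (2 * (N : ℝ) / (N - 1) - 1) = 2 * (N + 1) / (N - 1) := by field_simp; ring
    rw [h3]; field_simp; ring)
  refine ⟨(s * C ^ ((s : ℝ) - 1)) ^ (1 / (s : ℝ)), fun φ hφ hφc => ?_⟩
  set D := eLpNorm (fderiv ℝ φ) 2 (halfMeasure N) with hD
  have hs0 : (s : ℝ≥0∞) ≠ 0 := by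
    simp only [ne_eq, ENNReal.coe_eq_zero]; exact (zero_lt_one.trans hs1).ne'
  have hint : ∫⁻ y, ‖φ ((0 : ℝ), y)‖ₑ ^ (s : ℝ) ≤ s * (C * D) ^ ((s : ℝ) - 1) * D := by
    refine (lintegral_trace_rpow_le hs1 hφ hφc).trans ?_
    calc s * ((∫⁻ z, (‖φ z‖ₑ ^ ((s : ℝ) - 1)) ^ (2 : ℝ) ∂(halfMeasure N)) ^ (1 / (2 : ℝ)) * D)
      _ = s * (eLpNorm φ p (halfMeasure N) ^ ((s : ℝ) - 1) * D) := by
          congr 2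
          rw [eLpNorm_eq_lintegral_rpow_enorm_toReal (ENNReal.coe_ne_zero.2
            (mul_pos two_pos (tsub_pos_of_lt hs1)).ne') ENNReal.coe_ne_top,
            ← ENNReal.rpow_mul, ENNReal.coe_toReal, hpr]
          simp only [← ENNReal.rpow_mul]
          congr 1
          · congr 1 with z; congr 1; ring
          · have : (s : ℝ) - 1 ≠ 0 := by linarith
            field_simp
      _ ≤ s * ((C * D) ^ ((s : ℝ) - 1) * D) := by
          gcongr
          · linarith
          · exact hC φ hφ hφc
      _ = _ := by ring
  have hsp : (s : ℝ) ≠ 0 := by linarith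
  calc eLpNorm (fun y => φ (0, y)) s volume
      = (∫⁻ y, ‖φ ((0 : ℝ), y)‖ₑ ^ (s : ℝ)) ^ (1 / (s : ℝ)) := by
        rw [eLpNorm_eq_lintegral_rpow_enorm_toReal hs0 (by simp), ENNReal.coe_toReal]
    _ ≤ (s * (C * D) ^ ((s : ℝ) - 1) * D) ^ (1 / (s : ℝ)) := by gcongr
    _ = (s * C ^ ((s : ℝ) - 1) * D ^ (s : ℝ)) ^ (1 / (s : ℝ)) := by
        congr 1
        rw [ENNReal.mul_rpow_of_nonneg _ _ (by linarith), mul_assoc, mul_assoc, mul_assoc]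
        congr 2
        nth_rewrite 2 [← ENNReal.rpow_one D]
        rw [← ENNReal.rpow_add_of_nonneg _ _ (by linarith) (by norm_num)]
        congr 1; ring
    _ = _ := by
        rw [ENNReal.mul_rpow_of_nonneg _ _ (by positivity), ← ENNReal.rpow_mul,
          mul_one_div_cancel hsp, ENNReal.rpow_one, ENNReal.coe_rpow_of_nonneg _ (by positivity),
          ENNReal.coe_mul, ENNReal.coe_rpow_of_nonneg _ (by linarith)]

/-! ### Coordinates -/

/-- The standard basis of `ℝ^{N+1}`. -/
noncomputable def stdVec {N : ℕ} : Option (Fin N) → Amb N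
  | none => (1, 0)
  | some i => (0, EuclideanSpace.single i 1)

lemma dot_stdVec_none {N : ℕ} (a : Amb N) : dot a (stdVec none) = a.1 := by
  simp [dot, stdVec]

lemma dot_stdVec_some {N : ℕ} (a : Amb N) (i : Fin N) : dot a (stdVec (some i)) = a.2 i := by
  simp [dot, stdVec, EuclideanSpace.inner_single_right]

lemma dot_eq_sum {N : ℕ} (a b : Amb N) :
    dot a b = ∑ i, dot a (stdVec i) * dot b (stdVec i) := by
  rw [Fintype.sum_option]
  simp only [dot_stdVec_none, dot_stdVec_some]
  simp [dot, PiLp.inner_apply, mul_comm]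

lemma eq_sum_stdVec {N : ℕ} (a : Amb N) : a = ∑ i, dot a (stdVec i) • stdVec i := by
  rw [Fintype.sum_option, dot_stdVec_none]
  simp only [dot_stdVec_some]
  ext j
  · simp [stdVec, Prod.fst_sum]
  · simp [stdVec, Prod.snd_sum, Pi.single_apply]

lemma abs_dot_stdVec_le {N : ℕ} (a : Amb N) (i : Option (Fin N)) : |dot a (stdVec i)| ≤ ‖a‖ := by
  rw [Prod.norm_def]
  cases i with
  | none => rw [dot_stdVec_none]; exact le_max_left _ _
  | some i => rw [dot_stdVec_some]; exact (PiLp.norm_apply_le a.2 i).trans (le_max_right _ _)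

lemma enorm_clm_le_sum {N : ℕ} (L : Amb N →L[ℝ] ℝ) : ‖L‖ₑ ≤ ∑ i, ‖L (stdVec i)‖ₑ := by
  have h : ‖L‖ ≤ ∑ i, ‖L (stdVec i)‖ := by
    refine L.opNorm_le_bound (Finset.sum_nonneg fun _ _ => norm_nonneg _) fun a => ?_
    conv_lhs => rw [eq_sum_stdVec a, map_sum]
    refine (norm_sum_le _ _).trans ?_
    rw [Finset.sum_mul]
    refine Finset.sum_le_sum fun i _ => ?_
    rw [map_smul, norm_smul, mul_comm]
    exact mul_le_mul_of_nonneg_left (abs_dot_stdVec_le a i) (norm_nonneg _)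
  rw [← ofReal_norm]
  refine (ENNReal.ofReal_le_ofReal h).trans ?_
  rw [ENNReal.ofReal_sum_of_nonneg fun _ _ => norm_nonneg _]
  simp only [ofReal_norm, le_refl]

lemma continuous_dot_left {N : ℕ} (e : Amb N) : Continuous fun a : Amb N => dot a e := by
  unfold dot; fun_prop

lemma continuous_dot {N : ℕ} : Continuous fun p : Amb N × Amb N => dot p.1 p.2 := by
  unfold dot; fun_prop

lemma dot_smul_left {N : ℕ} (c : ℝ) (a b : Amb N) : dot (c • a) b = c * dot a b := by
  simp only [dot, Prod.smul_fst, Prod.smul_snd, smul_eq_mul, inner_smul_left]; simp; ring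

lemma dot_smul_right {N : ℕ} (c : ℝ) (a b : Amb N) : dot a (c • b) = c * dot a b := by
  simp only [dot, Prod.smul_fst, Prod.smul_snd, smul_eq_mul, inner_smul_right]; ring

lemma dot_sub_left {N : ℕ} (a a' b : Amb N) : dot (a - a') b = dot a b - dot a' b := by
  simp only [dot, Prod.fst_sub, Prod.snd_sub, inner_sub_left]; ring

lemma dot_self_nonneg {N : ℕ} (a : Amb N) : 0 ≤ dot a a := by
  rw [dot_eq_sum]; exact Finset.sum_nonneg fun _ _ => mul_self_nonneg _

lemma dot_stdVec_sq_le {N : ℕ} (a : Amb N) (i : Option (Fin N)) :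
    dot a (stdVec i) ^ 2 ≤ dot a a := by
  rw [dot_eq_sum a a, sq]
  exact Finset.single_le_sum (f := fun i => dot a (stdVec i) * dot a (stdVec i))
    (fun _ _ => mul_self_nonneg _) (Finset.mem_univ i)

lemma abs_dot_le {N : ℕ} (a b : Amb N) : |dot a b| ≤ 2 * (‖a‖ * ‖b‖) := by
  have h1 : |a.1 * b.1| ≤ ‖a‖ * ‖b‖ := by
    rw [abs_mul]
    exact mul_le_mul (norm_fst_le a) (norm_fst_le b) (abs_nonneg _) (norm_nonneg _)
  have h2 : |inner ℝ a.2 b.2| ≤ ‖a‖ * ‖b‖ :=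
    (abs_real_inner_le_norm _ _).trans
      (mul_le_mul (norm_snd_le a) (norm_snd_le b) (norm_nonneg _) (norm_nonneg _))
  exact (abs_add_le _ _).trans (by linarith)

lemma memLp_dot {N : ℕ} {μ : Measure (Amb N)} {p : ℝ≥0∞} {G : Amb N → Amb N} (hG : MemLp G p μ)
    (e : Amb N) : MemLp (fun z => dot (G z) e) p μ := by
  refine hG.of_le_mul (c := 2 * ‖e‖)
    ((continuous_dot_left e).comp_aestronglyMeasurable hG.aestronglyMeasurable)
    (Eventually.of_forall fun z => (abs_dot_le _ _).trans (le_of_eq (by ring)))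

lemma integrable_dot {N : ℕ} {μ : Measure (Amb N)} {G H : Amb N → Amb N} (hG : MemLp G 2 μ)
    (hH : MemLp H 2 μ) : Integrable (fun z => dot (G z) (H z)) μ := by
  have := (hG.norm.integrable_mul hH.norm).const_mul 2
  refine this.mono'
    (continuous_dot.comp_aestronglyMeasurable
      (hG.aestronglyMeasurable.prodMk hH.aestronglyMeasurable))
    (Eventually.of_forall fun z => abs_dot_le _ _)

/-! ### Weak gradients -/

lemma memLp_of_continuous_compact {N : ℕ} {φ : Amb N → ℝ} (hφ : Continuous φ)
    (hc : HasCompactSupport φ) (p : ℝ≥0∞) : MemLp φ p (halfMeasure N) :=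
  (hφ.memLp_of_hasCompactSupport hc (μ := (volume : Measure (Amb N)))).restrict _

lemma continuous_fderiv_apply_of_smooth {N : ℕ} {φ : Amb N → ℝ} (hφ : ContDiff ℝ ∞ φ)
    (e : Amb N) : Continuous fun z => fderiv ℝ φ z e :=
  (hφ.continuous_fderiv (by simp)).clm_apply continuous_const

lemma eLpNorm_fderiv_le_sum {N : ℕ} {φ : Amb N → ℝ} (hφ : ContDiff ℝ ∞ φ) :
    eLpNorm (fderiv ℝ φ) 2 (halfMeasure N) ≤
      ∑ i, eLpNorm (fun z => fderiv ℝ φ z (stdVec i)) 2 (halfMeasure N) := by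
  refine le_trans (eLpNorm_mono_enorm (g := fun z => ∑ i, ‖fderiv ℝ φ z (stdVec i)‖ₑ)
    fun z => by simpa using enorm_clm_le_sum (fderiv ℝ φ z)) ?_
  have := eLpNorm_sum_le (μ := halfMeasure N) (p := 2) (s := Finset.univ)
    (f := fun i z => ‖fderiv ℝ φ z (stdVec i)‖ₑ)
    (fun i _ => (continuous_fderiv_apply_of_smooth hφ (stdVec i)).enorm.aestronglyMeasurable)
    (by norm_num)
  refine le_trans (le_of_eq ?_) (this.trans (le_of_eq ?_))
  · congr 1; ext z; simp
  · simp

lemma memLp_fderiv_apply {N : ℕ} {φ : Amb N → ℝ} (hφ : ContDiff ℝ ∞ φ)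
    (hc : HasCompactSupport φ) (e : Amb N) (p : ℝ≥0∞) :
    MemLp (fun z => fderiv ℝ φ z e) p (halfMeasure N) :=
  memLp_of_continuous_compact (continuous_fderiv_apply_of_smooth hφ e)
    (hc.fderiv_apply (𝕜 := ℝ) e) p

lemma MemH1.isWeakGrad {N : ℕ} {v : Amb N → ℝ} (hv : MemH1 v) : IsWeakGrad v (weakGrad v) := by
  rw [weakGrad, dif_pos hv.2]; exact hv.2.choose_spec

lemma IsWeakGrad.ae_eq {N : ℕ} {v : Amb N → ℝ} {G H : Amb N → Amb N} (hG : IsWeakGrad v G)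
    (hH : IsWeakGrad v H) : G =ᵐ[halfMeasure N] H := by
  have key : ∀ i : Option (Fin N), ∀ᵐ z ∂(halfMeasure N), dot (G z - H z) (stdVec i) = 0 := by
    intro i
    have hm : MemLp (fun z => dot (G z - H z) (stdVec i)) 2 (halfMeasure N) :=
      memLp_dot (hG.1.sub hH.1) _
    have hloc : IsLocallyFiniteMeasure (halfMeasure N) := by unfold halfMeasure; infer_instance
    have := (isOpen_halfSpace N).ae_eq_zero_of_integral_contDiff_smul_eq_zero
      (μ := halfMeasure N) ((hm.locallyIntegrable (by norm_num)).locallyIntegrableOn _)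
      fun φ hφ hc hs => by
        have h1 := hG.2 φ hφ hc hs (stdVec i)
        rw [hH.2 φ hφ hc hs (stdVec i)] at h1
        have hφ2 := memLp_of_continuous_compact hφ.continuous hc 2
        have e1 : ∀ z, φ z • dot (G z - H z) (stdVec i) =
            dot (G z) (stdVec i) * φ z - dot (H z) (stdVec i) * φ z := fun z => by
          rw [dot_sub_left, smul_eq_mul]; ring
        simp only [e1]
        have := integral_sub ((memLp_dot hG.1 (stdVec i)).integrable_mul hφ2)
          ((memLp_dot hH.1 (stdVec i)).integrable_mul hφ2)
        simp only [Pi.mul_apply] at this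
        linarith
    filter_upwards [this, ae_restrict_mem (measurableSet_halfSpace N)] with z h1 h2 using h1 h2
  filter_upwards [ae_all_iff.2 key] with z hz
  rw [← sub_eq_zero, eq_sum_stdVec (G z - H z)]
  simp [hz]

lemma tendsto_integral_mul_of_tendsto_eLpNorm {α : Type*} [MeasurableSpace α] {μ : Measure α}
    {F : ℕ → α → ℝ} {f g : α → ℝ} (hF : ∀ n, MemLp (F n) 2 μ) (hf : MemLp f 2 μ)
    (hg : MemLp g 2 μ) (h : Tendsto (fun n => eLpNorm (fun z => F n z - f z) 2 μ) atTop (𝓝 0)) :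
    Tendsto (fun n => ∫ z, F n z * g z ∂μ) atTop (𝓝 (∫ z, f z * g z ∂μ)) := by
  refine tendsto_integral_of_L1' (fun z => f z * g z) (hf.integrable_mul hg).aestronglyMeasurable
    (Eventually.of_forall fun n => (hF n).integrable_mul hg) ?_
  have h2 : Tendsto (fun n => eLpNorm (fun z => F n z - f z) 2 μ * eLpNorm g 2 μ) atTop (𝓝 0) := by
    simpa using ENNReal.Tendsto.mul_const h (Or.inr hg.eLpNorm_ne_top)
  refine tendsto_of_tendsto_of_tendsto_of_le_of_le tendsto_const_nhds h2 (fun _ => zero_le)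
    fun n => ?_
  have := eLpNorm_smul_le_mul_eLpNorm (p := 2) (q := 2) (r := 1) (μ := μ)
    hg.aestronglyMeasurable ((hF n).sub hf).aestronglyMeasurable
  refine le_trans (le_of_eq ?_) this
  congr 1
  ext z; simp [sub_mul]

/-- A limit in `L²` of smooth functions whose derivatives converge in `L²` is weakly
differentiable. -/
lemma isWeakGrad_of_tendsto {N : ℕ} {w : Amb N → ℝ} {H : Amb N → Amb N} {ψ : ℕ → Amb N → ℝ}
    (hψ : ∀ n, ContDiff ℝ ∞ (ψ n) ∧ HasCompactSupport (ψ n))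
    (hw : MemLp w 2 (halfMeasure N)) (hH : MemLp H 2 (halfMeasure N))
    (h0 : Tendsto (fun n => eLpNorm (fun z => ψ n z - w z) 2 (halfMeasure N)) atTop (𝓝 0))
    (h1 : ∀ e : Amb N, Tendsto (fun n => eLpNorm (fun z => fderiv ℝ (ψ n) z e - dot (H z) e) 2
        (halfMeasure N)) atTop (𝓝 0)) : IsWeakGrad w H := by
  refine ⟨hH, fun φ hφ hc hs e => ?_⟩
  have a1 := tendsto_integral_mul_of_tendsto_eLpNorm
    (fun n => memLp_of_continuous_compact (hψ n).1.continuous (hψ n).2 2) hw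
    (memLp_fderiv_apply hφ hc e 2) h0
  have a2 := tendsto_integral_mul_of_tendsto_eLpNorm
    (fun n => memLp_fderiv_apply (hψ n).1 (hψ n).2 e 2) (memLp_dot hH e)
    (memLp_of_continuous_compact hφ.continuous hc 2) (h1 e)
  refine tendsto_nhds_unique a1 ?_
  refine a2.neg.congr fun n => ?_
  have hz : ∀ z ∉ halfSpace N, φ z = 0 := fun z hz =>
    image_eq_zero_of_notMem_tsupport fun h => hz (hs h)
  have hz' : ∀ z ∉ halfSpace N, fderiv ℝ φ z e = 0 := fun z hz => by
    rw [image_eq_zero_of_notMem_tsupport fun h => hz (hs (tsupport_fderiv_subset ℝ h))]; rfl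
  rw [halfMeasure,
    setIntegral_eq_integral_of_forall_compl_eq_zero fun z h => by rw [hz z h, mul_zero],
    setIntegral_eq_integral_of_forall_compl_eq_zero fun z h => by rw [hz' z h, mul_zero]]
  have c0 := (hψ n).1.continuous
  have c1 := continuous_fderiv_apply_of_smooth (hψ n).1 e
  have d0 := hφ.continuous
  have d1 := continuous_fderiv_apply_of_smooth hφ e
  refine (integral_mul_fderiv_eq_neg_fderiv_mul_of_integrable ?_ ?_ ?_
    (fun z _ => (hψ n).1.differentiable (by simp) z)
    (fun z _ => hφ.differentiable (by simp) z)).symm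
  · exact (c1.mul d0).integrable_of_hasCompactSupport hc.mul_left
  · exact (c0.mul d1).integrable_of_hasCompactSupport (hψ n).2.mul_right
  · exact (c0.mul d0).integrable_of_hasCompactSupport hc.mul_left

/-! ### Traces -/

/-- The trace inequality passes to `L²` limits. -/
lemma exists_trace_limit (N : ℕ) (hN : 2 ≤ N) {s : ℝ≥0} (hs : (s : ℝ) = 2 * N / (N - 1)) :
    ∃ C : ℝ≥0, ∀ (ψ : ℕ → Amb N → ℝ) (g : Bdry N → ℝ) (d : Option (Fin N) → ℝ≥0∞),
      (∀ n, ContDiff ℝ ∞ (ψ n) ∧ HasCompactSupport (ψ n)) → MemLp g 2 volume →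
      Tendsto (fun n => eLpNorm (fun y => ψ n (0, y) - g y) 2 volume) atTop (𝓝 0) →
      (∀ i, Tendsto (fun n => eLpNorm (fun z => fderiv ℝ (ψ n) z (stdVec i)) 2 (halfMeasure N))
        atTop (𝓝 (d i))) →
      eLpNorm g s volume ≤ C * ∑ i, d i := by
  obtain ⟨C, hC⟩ := exists_trace_smooth N hN hs
  refine ⟨C, fun ψ g d hψ hg h0 h1 => ?_⟩
  have hcont : ∀ n, Continuous fun y : Bdry N => ψ n (0, y) := fun n =>
    (hψ n).1.continuous.comp (by fun_prop)
  obtain ⟨ns, hns, hae⟩ := (tendstoInMeasure_of_tendsto_eLpNorm (by norm_num)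
    (fun n => (hcont n).aestronglyMeasurable) hg.aestronglyMeasurable h0).exists_seq_tendsto_ae
  refine (Lp.eLpNorm_lim_le_liminf_eLpNorm
    (fun n => (hcont (ns n)).aestronglyMeasurable) g hae).trans ?_
  have hb : ∀ n, eLpNorm (fun y => ψ n (0, y)) s volume ≤
      C * ∑ i, eLpNorm (fun z => fderiv ℝ (ψ n) z (stdVec i)) 2 (halfMeasure N) := fun n => by
    refine (hC _ (hψ n).1 (hψ n).2).trans ?_
    gcongr
    exact eLpNorm_fderiv_le_sum (hψ n).1
  have hlim : Tendsto (fun n => C * ∑ i, eLpNorm (fun z => fderiv ℝ (ψ (ns n)) z (stdVec i)) 2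
      (halfMeasure N)) atTop (𝓝 (C * ∑ i, d i)) :=
    ENNReal.Tendsto.const_mul (tendsto_finsetSum _ fun i _ => (h1 i).comp hns.tendsto_atTop)
      (Or.inr ENNReal.coe_ne_top)
  exact (liminf_le_liminf (Eventually.of_forall fun n => hb (ns n))).trans hlim.liminf_eq.le

lemma tendsto_eLpNorm_of_tendsto_sub {α : Type*} [MeasurableSpace α] {μ : Measure α}
    {F : ℕ → α → ℝ} {f : α → ℝ} (hF : ∀ n, AEStronglyMeasurable (F n) μ) (hf : MemLp f 2 μ)
    (h : Tendsto (fun n => eLpNorm (fun z => F n z - f z) 2 μ) atTop (𝓝 0)) :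
    Tendsto (fun n => eLpNorm (F n) 2 μ) atTop (𝓝 (eLpNorm f 2 μ)) := by
  have hm : ∀ n, AEStronglyMeasurable (fun z => F n z - f z) μ := fun n =>
    (hF n).sub hf.aestronglyMeasurable
  have u : Tendsto (fun n => eLpNorm f 2 μ + eLpNorm (fun z => F n z - f z) 2 μ) atTop
      (𝓝 (eLpNorm f 2 μ)) := by simpa using tendsto_const_nhds.add h
  have l : Tendsto (fun n => eLpNorm f 2 μ - eLpNorm (fun z => F n z - f z) 2 μ) atTop
      (𝓝 (eLpNorm f 2 μ)) := by
    simpa using ENNReal.Tendsto.sub tendsto_const_nhds h (Or.inl hf.eLpNorm_ne_top)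
  refine tendsto_of_tendsto_of_tendsto_of_le_of_le l u (fun n => ?_) fun n => ?_
  · rw [tsub_le_iff_right]
    have := eLpNorm_sub_le (hF n) (hm n) (p := 2) (by norm_num)
    refine le_trans (le_of_eq ?_) this
    congr 1; ext z; simp
  · have := eLpNorm_add_le hf.aestronglyMeasurable (hm n) (p := 2) (by norm_num)
    refine le_trans (le_of_eq ?_) this
    congr 1; ext z; simp

lemma IsTrace.ae_eq {N : ℕ} (hN : 2 ≤ N) {v : Amb N → ℝ} {u u' : Bdry N → ℝ} (hv : MemH1 v)
    (h : IsTrace v u) (h' : IsTrace v u') : u =ᵐ[volume] u' := by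
  have hN' : (2 : ℝ) ≤ N := by exact_mod_cast hN
  have hs0 : (0 : ℝ) < 2 * N / (N - 1) := div_pos (by linarith) (by linarith)
  obtain ⟨s, hs⟩ : ∃ s : ℝ≥0, (s : ℝ) = 2 * N / (N - 1) := ⟨⟨_, hs0.le⟩, rfl⟩
  obtain ⟨C, hC⟩ := exists_trace_limit N hN hs
  obtain ⟨hu, φ, hφ, a0, a1, a2⟩ := h
  obtain ⟨hu', φ', hφ', b0, b1, b2⟩ := h'
  have hsum : ∀ {α : Type} [MeasurableSpace α] (μ : Measure α) (F F' : ℕ → α → ℝ) (f f' : α → ℝ),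
      (∀ n, AEStronglyMeasurable (fun z => F n z - f z) μ) →
      (∀ n, AEStronglyMeasurable (fun z => F' n z - f' z) μ) →
      Tendsto (fun n => eLpNorm (fun z => F n z - f z) 2 μ) atTop (𝓝 0) →
      Tendsto (fun n => eLpNorm (fun z => F' n z - f' z) 2 μ) atTop (𝓝 0) →
      Tendsto (fun n => eLpNorm (fun z => F n z - F' n z - (f z - f' z)) 2 μ) atTop (𝓝 0) := by
    intro α _ μ F F' f f' hm hm' h h'
    refine tendsto_of_tendsto_of_tendsto_of_le_of_le tendsto_const_nhds
      (by simpa using h.add h') (fun _ => zero_le) fun n => ?_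
    refine le_trans (le_of_eq ?_) (eLpNorm_sub_le (hm n) (hm' n) (p := 2) (by norm_num))
    congr 1; ext z; simp; ring
  have hG := hv.isWeakGrad.1
  have key := hC (fun n z => φ n z - φ' n z) (fun y => u y - u' y) (fun _ => 0)
    (fun n => ⟨(hφ n).1.sub (hφ' n).1, (hφ n).2.sub (hφ' n).2⟩) (hu.sub hu')
    (hsum _ _ _ _ _
      (fun n => (((hφ n).1.continuous.comp (by fun_prop : Continuous fun y : Bdry N =>
        ((0 : ℝ), y))).aestronglyMeasurable).sub hu.aestronglyMeasurable)
      (fun n => (((hφ' n).1.continuous.comp (by fun_prop : Continuous fun y : Bdry N =>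
        ((0 : ℝ), y))).aestronglyMeasurable).sub hu'.aestronglyMeasurable) a2 b2)
    (fun i => by
      have := hsum _ _ _ _ _
        (fun n => ((continuous_fderiv_apply_of_smooth (hφ n).1
          (stdVec i)).aestronglyMeasurable).sub (memLp_dot hG (stdVec i)).aestronglyMeasurable)
        (fun n => ((continuous_fderiv_apply_of_smooth (hφ' n).1
          (stdVec i)).aestronglyMeasurable).sub (memLp_dot hG (stdVec i)).aestronglyMeasurable)
        (a1 (stdVec i)) (b1 (stdVec i))
      refine this.congr fun n => ?_
      congr 1; ext z
      rw [show (fun z => φ n z - φ' n z) = φ n - φ' n from rfl,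
        fderiv_sub ((hφ n).1.differentiable (by simp) _) ((hφ' n).1.differentiable (by simp) _)]
      simp)
  simp only [Finset.sum_const_zero, mul_zero, nonpos_iff_eq_zero] at key
  have key' := (eLpNorm_eq_zero_iff (hu.sub hu').aestronglyMeasurable
    (ENNReal.coe_ne_zero.2 (NNReal.coe_pos.1 (hs ▸ hs0)).ne')).1 key
  filter_upwards [key'] with y hy
  simpa [sub_eq_zero] using hy

lemma IsTrace.trace_ae_eq {N : ℕ} (hN : 2 ≤ N) {v : Amb N → ℝ} {u : Bdry N → ℝ} (hv : MemH1 v)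
    (h : IsTrace v u) : trace v =ᵐ[volume] u := by
  have hex : ∃ u : Bdry N → ℝ, IsTrace v u := ⟨u, h⟩
  rw [trace, dif_pos hex]
  exact hex.choose_spec.ae_eq hN hv h

/-- The trace inequality in `H¹`. -/
lemma exists_trace_bound (N : ℕ) (hN : 2 ≤ N) {s : ℝ≥0} (hs : (s : ℝ) = 2 * N / (N - 1)) :
    ∃ C : ℝ≥0, ∀ (v : Amb N → ℝ) (u : Bdry N → ℝ), MemH1 v → IsTrace v u →
      eLpNorm u s volume ≤
        C * ENNReal.ofReal √(∫ z, dot (weakGrad v z) (weakGrad v z) ∂(halfMeasure N)) := by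
  obtain ⟨C, hC⟩ := exists_trace_limit N hN hs
  refine ⟨C * (N + 1), fun v u hv ⟨hu, φ, hφ, _, a1, a2⟩ => ?_⟩
  have hG := hv.isWeakGrad.1
  have key := hC φ u (fun i => eLpNorm (fun z => dot (weakGrad v z) (stdVec i)) 2 (halfMeasure N))
    hφ hu a2 fun i => tendsto_eLpNorm_of_tendsto_sub
      (fun n => (continuous_fderiv_apply_of_smooth (hφ n).1 _).aestronglyMeasurable)
      (memLp_dot hG _) (a1 _)
  refine key.trans ?_
  rw [ENNReal.coe_mul, mul_assoc]
  gcongr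
  have : ∀ i ∈ (Finset.univ : Finset (Option (Fin N))),
      eLpNorm (fun z => dot (weakGrad v z) (stdVec i)) 2 (halfMeasure N) ≤
      ENNReal.ofReal √(∫ z, dot (weakGrad v z) (weakGrad v z) ∂(halfMeasure N)) := fun i _ => by
    rw [(memLp_dot hG (stdVec i)).eLpNorm_eq_integral_rpow_norm (by norm_num) (by norm_num),
      Real.sqrt_eq_rpow]
    refine ENNReal.ofReal_le_ofReal ?_
    simp only [ENNReal.toReal_ofNat, Real.rpow_ofNat, Real.norm_eq_abs, sq_abs, one_div]
    refine Real.rpow_le_rpow (integral_nonneg fun z => sq_nonneg _) ?_ (by norm_num)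
    refine integral_mono (memLp_dot hG (stdVec i)).integrable_sq (integrable_dot hG hG) fun z => ?_
    exact dot_stdVec_sq_le _ i
  refine (Finset.sum_le_card_nsmul _ _ _ this).trans (le_of_eq ?_)
  simp

/-! ### Chain rule -/

lemma tendsto_eLpNorm_mul_of_dominated {α : Type*} [MeasurableSpace α] {μ : Measure α}
    {F : ℕ → α → ℝ} {g : α → ℝ} {C : ℝ} (hF : ∀ n, AEStronglyMeasurable (F n) μ)
    (hb : ∀ n z, |F n z| ≤ C) (hg : MemLp g 2 μ)
    (h : ∀ᵐ z ∂μ, Tendsto (fun n => F n z) atTop (𝓝 0)) :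
    Tendsto (fun n => eLpNorm (fun z => F n z * g z) 2 μ) atTop (𝓝 0) := by
  have key : Tendsto (fun n => ∫⁻ z, ‖F n z * g z‖ₑ ^ (2 : ℝ) ∂μ) atTop (𝓝 (∫⁻ _, 0 ∂μ)) := by
    refine tendsto_lintegral_of_dominated_convergence' (fun z => ‖C * g z‖ₑ ^ (2 : ℝ))
      (fun n => ((hF n).mul hg.aestronglyMeasurable).enorm.pow_const _)
      (fun n => Eventually.of_forall fun z => ?_) ?_ ?_
    · refine ENNReal.rpow_le_rpow ?_ (by norm_num)
      rw [enorm_mul, enorm_mul]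
      gcongr
      rw [← ofReal_norm, ← ofReal_norm]
      exact ENNReal.ofReal_le_ofReal ((hb n z).trans (le_abs_self C))
    · have := (hg.const_mul C).eLpNorm_lt_top
      rw [eLpNorm_lt_top_iff_lintegral_rpow_enorm_lt_top (by norm_num) (by norm_num)] at this
      simpa using this.ne
    · filter_upwards [h] with z hz
      have h1 : Tendsto (fun n => ‖F n z * g z‖ₑ) atTop (𝓝 0) := by
        have := (hz.mul_const (g z)).enorm
        simpa using this
      have := (ENNReal.continuous_rpow_const (y := 2)).tendsto 0 |>.comp h1
      simpa [Function.comp_def] using this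
  simp only [lintegral_zero] at key
  have := (ENNReal.continuous_rpow_const (y := 1 / 2)).tendsto 0 |>.comp key
  simp only [eLpNorm_eq_lintegral_rpow_enorm_toReal (two_ne_zero) (ENNReal.ofNat_ne_top),
    ENNReal.toReal_ofNat]
  simpa [Function.comp_def] using this

/-- Chain rule in `H¹` and for the trace. -/
lemma IsTrace.comp {N : ℕ} {v : Amb N → ℝ} {u : Bdry N → ℝ} (hv : MemH1 v) (h : IsTrace v u)
    {Φ : ℝ → ℝ} (hΦ : ContDiff ℝ ∞ Φ) (hΦ0 : Φ 0 = 0) (hΦ1 : ∀ t, |deriv Φ t| ≤ 1) :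
    MemH1 (fun z => Φ (v z)) ∧
    weakGrad (fun z => Φ (v z)) =ᵐ[halfMeasure N] (fun z => deriv Φ (v z) • weakGrad v z) ∧
    IsTrace (fun z => Φ (v z)) (fun y => Φ (u y)) := by
  obtain ⟨hu, φ, hφ, a0, a1, a2⟩ := h
  have hvL := hv.1
  have hG := hv.isWeakGrad.1
  have hLip : ∀ a b, |Φ a - Φ b| ≤ |a - b| := fun a b => by
    have := Convex.norm_image_sub_le_of_norm_deriv_le (f := Φ) (C := 1) (s := univ)
      (x := b) (y := a)
      (fun x _ => hΦ.differentiable (by simp) x) (fun x _ => hΦ1 x) convex_univ trivial trivial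
    simpa using this
  have hLip0 : ∀ a, |Φ a| ≤ |a| := fun a => by simpa [hΦ0] using hLip a 0
  have hdc : Continuous (deriv Φ) := hΦ.continuous_deriv (by simp)
  obtain ⟨ns, hns, hae⟩ := (tendstoInMeasure_of_tendsto_eLpNorm (by norm_num)
    (fun n => (hφ n).1.continuous.aestronglyMeasurable) hvL.aestronglyMeasurable
    a0).exists_seq_tendsto_ae
  set ψ : ℕ → Amb N → ℝ := fun n z => Φ (φ (ns n) z) with hψdef
  have hψ : ∀ n, ContDiff ℝ ∞ (ψ n) ∧ HasCompactSupport (ψ n) := fun n =>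
    ⟨hΦ.comp (hφ _).1, (hφ _).2.comp_left hΦ0⟩
  have hwL : MemLp (fun z => Φ (v z)) 2 (halfMeasure N) :=
    hvL.of_le (hΦ.continuous.comp_aestronglyMeasurable hvL.aestronglyMeasurable)
      (Eventually.of_forall fun z => hLip0 _)
  have hdm : AEStronglyMeasurable (fun z => deriv Φ (v z)) (halfMeasure N) :=
    hdc.comp_aestronglyMeasurable hvL.aestronglyMeasurable
  have hHL : MemLp (fun z => deriv Φ (v z) • weakGrad v z) 2 (halfMeasure N) := by
    refine hG.of_le (hdm.smul hG.aestronglyMeasurable) (Eventually.of_forall fun z => ?_)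
    rw [norm_smul]
    exact mul_le_of_le_one_left (norm_nonneg _) (hΦ1 _)
  have b0 : Tendsto (fun n => eLpNorm (fun z => ψ n z - Φ (v z)) 2 (halfMeasure N)) atTop (𝓝 0) :=
    tendsto_of_tendsto_of_tendsto_of_le_of_le tendsto_const_nhds (a0.comp hns.tendsto_atTop)
      (fun _ => zero_le) fun n => eLpNorm_mono fun z => hLip _ _
  have b2 : Tendsto (fun n => eLpNorm (fun y => ψ n (0, y) - Φ (u y)) 2 volume) atTop (𝓝 0) :=
    tendsto_of_tendsto_of_tendsto_of_le_of_le tendsto_const_nhds (a2.comp hns.tendsto_atTop)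
      (fun _ => zero_le) fun n => eLpNorm_mono fun z => hLip _ _
  have b1 : ∀ e : Amb N, Tendsto (fun n => eLpNorm (fun z => fderiv ℝ (ψ n) z e -
      dot (deriv Φ (v z) • weakGrad v z) e) 2 (halfMeasure N)) atTop (𝓝 0) := fun e => by
    have c1 := (a1 e).comp hns.tendsto_atTop
    have c2 : Tendsto (fun n => eLpNorm (fun z => (deriv Φ (φ (ns n) z) - deriv Φ (v z)) *
        dot (weakGrad v z) e) 2 (halfMeasure N)) atTop (𝓝 0) := by
      refine tendsto_eLpNorm_mul_of_dominated (C := 2)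
        (fun n => ((hdc.comp (hφ _).1.continuous).aestronglyMeasurable).sub hdm)
        (fun n z => ?_) (memLp_dot hG e) ?_
      · exact (abs_sub _ _).trans (by linarith [hΦ1 (φ (ns n) z), hΦ1 (v z)])
      · filter_upwards [hae] with z hz
        have := ((hdc.tendsto (v z)).comp hz).sub_const (deriv Φ (v z))
        simpa using this
    refine tendsto_of_tendsto_of_tendsto_of_le_of_le tendsto_const_nhds
      (by simpa using c1.add c2) (fun _ => zero_le) fun n => ?_
    have hm1 : AEStronglyMeasurable (fun z => deriv Φ (φ (ns n) z) *
        (fderiv ℝ (φ (ns n)) z e - dot (weakGrad v z) e)) (halfMeasure N) :=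
      ((hdc.comp (hφ _).1.continuous).aestronglyMeasurable).mul
        ((continuous_fderiv_apply_of_smooth (hφ _).1 e).aestronglyMeasurable.sub
          (memLp_dot hG e).aestronglyMeasurable)
    have hm2 : AEStronglyMeasurable (fun z => (deriv Φ (φ (ns n) z) - deriv Φ (v z)) *
        dot (weakGrad v z) e) (halfMeasure N) :=
      (((hdc.comp (hφ _).1.continuous).aestronglyMeasurable).sub hdm).mul
        (memLp_dot hG e).aestronglyMeasurable
    have hle := eLpNorm_add_le hm1 hm2 (p := 2) (by norm_num)
    refine le_trans (le_of_eq ?_) (hle.trans (add_le_add (eLpNorm_mono fun z => ?_) le_rfl))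
    · congr 1; ext z
      have : fderiv ℝ (ψ n) z = deriv Φ (φ (ns n) z) • fderiv ℝ (φ (ns n)) z :=
        ((hΦ.differentiable (by simp) _).hasDerivAt.comp_hasFDerivAt z
          ((hφ _).1.differentiable (by simp) z).hasFDerivAt).fderiv
      rw [this, dot_smul_left]
      simp only [_root_.smul_apply, smul_eq_mul, Pi.add_apply]
      ring
    · rw [norm_mul]
      exact mul_le_of_le_one_left (norm_nonneg _) (hΦ1 _)
  have hgrad := isWeakGrad_of_tendsto hψ hwL hHL b0 b1
  have hmem : MemH1 (fun z => Φ (v z)) := ⟨hwL, _, hgrad⟩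
  have hae' := hmem.isWeakGrad.ae_eq hgrad
  refine ⟨hmem, hae', hu.of_le (hΦ.continuous.comp_aestronglyMeasurable hu.aestronglyMeasurable)
      (Eventually.of_forall fun z => hLip0 _), ψ, hψ, b0, fun e => ?_, b2⟩
  refine (b1 e).congr fun n => eLpNorm_congr_ae ?_
  filter_upwards [hae'] with z hz
  rw [hz]

/-! ### Truncations -/

/-- `Φ` is a smooth version of the truncation `t ↦ sign t * (|t| - k)⁺`, up to an error `δ`. -/
structure IsTruncation (k δ : ℝ) (Φ : ℝ → ℝ) : Prop where
  smooth : ContDiff ℝ ∞ Φ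
  zero : Φ 0 = 0
  deriv_nonneg : ∀ t, 0 ≤ deriv Φ t
  deriv_le_one : ∀ t, deriv Φ t ≤ 1
  eq_zero : ∀ t, |t| ≤ k → Φ t = 0
  mul_nonneg : ∀ t, 0 ≤ t * Φ t
  abs_le : ∀ t, |Φ t| ≤ |t|
  le_abs : ∀ t, |t| - k - δ ≤ |Φ t|

lemma exists_isTruncation {k δ : ℝ} (hk : 0 < k) (hδ : 0 < δ) : ∃ Φ, IsTruncation k δ Φ := by
  set ρ : ℝ → ℝ := fun s => Real.smoothTransition ((s - k) / δ) +
    Real.smoothTransition ((-s - k) / δ) with hρ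
  have hρc : ContDiff ℝ ∞ ρ := by
    refine ContDiff.add (Real.smoothTransition.contDiff.comp ?_)
      (Real.smoothTransition.contDiff.comp ?_) <;> fun_prop
  have hneg : ∀ s, ρ (-s) = ρ s := fun s => by simp only [hρ, neg_neg]; ring
  have hz : ∀ s, s ≤ k → Real.smoothTransition ((s - k) / δ) = 0 := fun s hs =>
    Real.smoothTransition.zero_of_nonpos (div_nonpos_of_nonpos_of_nonneg (by linarith) hδ.le)
  have h0 : ∀ s, 0 ≤ ρ s := fun s =>
    add_nonneg (Real.smoothTransition.nonneg _) (Real.smoothTransition.nonneg _)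
  have h1 : ∀ s, ρ s ≤ 1 := fun s => by
    rcases le_total 0 s with hs | hs
    · simp only [hρ, hz (-s) (by linarith), add_zero]; exact Real.smoothTransition.le_one _
    · simp only [hρ, hz s (by linarith), zero_add]; exact Real.smoothTransition.le_one _
  have hk0 : ∀ s, |s| ≤ k → ρ s = 0 := fun s hs => by
    simp only [hρ, hz s ((le_abs_self s).trans hs), hz (-s) ((neg_le_abs s).trans hs), add_zero]
  have hk1 : ∀ s, k + δ ≤ s → ρ s = 1 := fun s hs => by
    simp only [hρ, hz (-s) (by linarith), add_zero]
    exact Real.smoothTransition.one_of_one_le (by rw [le_div_iff₀ hδ]; linarith)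
  set Φ : ℝ → ℝ := fun t => ∫ s in (0 : ℝ)..t, ρ s with hΦ
  have hd : ∀ t, HasDerivAt Φ (ρ t) t := fun t =>
    intervalIntegral.integral_hasDerivAt_right (hρc.continuous.intervalIntegrable _ _)
      (hρc.continuous.stronglyMeasurableAtFilter _ _) hρc.continuous.continuousAt
  have hd' : deriv Φ = ρ := funext fun t => (hd t).deriv
  have hΦ0 : Φ 0 = 0 := by simp [hΦ]
  have hΦneg : ∀ t, Φ (-t) = -Φ t := fun t => by
    have := intervalIntegral.integral_comp_neg (a := 0) (b := t) ρ
    simp only [hneg, neg_zero] at this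
    rw [hΦ]; beta_reduce
    rw [this, intervalIntegral.integral_symm]
  have hmono : Monotone Φ := monotone_of_deriv_nonneg (fun t => (hd t).differentiableAt)
    fun t => by rw [hd']; exact h0 t
  have hd2 : ∀ t, HasDerivAt (fun t => t - Φ t) (1 - ρ t) t := fun t =>
    (hasDerivAt_id' t).sub (hd t)
  have hmono' : Monotone fun t => t - Φ t :=
    monotone_of_deriv_nonneg (fun t => (hd2 t).differentiableAt) fun t => by
      rw [(hd2 t).deriv]; linarith [h1 t]
  have hpos : ∀ t, 0 ≤ t → 0 ≤ Φ t ∧ Φ t ≤ t ∧ t - k - δ ≤ Φ t := fun t ht => by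
    refine ⟨hΦ0 ▸ hmono ht, ?_, ?_⟩
    · have := hmono' ht; simp only [hΦ0] at this; linarith
    · rcases le_total t (k + δ) with h | h
      · have := hmono ht; rw [hΦ0] at this; linarith
      · have e : Φ t = Φ (k + δ) + ∫ s in (k + δ)..t, ρ s :=
          (intervalIntegral.integral_add_adjacent_intervals
            (hρc.continuous.intervalIntegrable _ _) (hρc.continuous.intervalIntegrable _ _)).symm
        have e2 : ∫ s in (k + δ)..t, ρ s = t - (k + δ) := by
          rw [intervalIntegral.integral_congr (g := fun _ => (1 : ℝ))]
          · simp
          · intro s hs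
            rw [uIcc_of_le h] at hs
            exact hk1 s hs.1
        have := hmono (show 0 ≤ k + δ by positivity)
        rw [hΦ0] at this; linarith
  refine ⟨Φ, ?_, hΦ0, fun t => hd' ▸ h0 t, fun t => hd' ▸ h1 t, fun t ht => ?_, fun t => ?_,
    fun t => ?_, fun t => ?_⟩
  · rw [contDiff_infty_iff_deriv]
    exact ⟨fun t => (hd t).differentiableAt, hd' ▸ hρc⟩
  · rw [hΦ]; beta_reduce
    rw [intervalIntegral.integral_congr (g := fun _ => (0 : ℝ))]
    · simp
    · intro s hs
      refine hk0 s (le_trans ?_ ht)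
      rcases le_total 0 t with h | h
      · rw [uIcc_of_le h] at hs
        rw [abs_of_nonneg hs.1, abs_of_nonneg h]; exact hs.2
      · rw [uIcc_of_ge h] at hs
        rw [abs_of_nonpos hs.2, abs_of_nonpos h]; linarith [hs.1]
  · rcases le_total 0 t with h | h
    · exact mul_nonneg h (hpos t h).1
    · exact mul_nonneg_of_nonpos_of_nonpos h (hΦ0 ▸ hmono h)
  · rcases le_total 0 t with h | h
    · rw [abs_of_nonneg h, abs_of_nonneg (hpos t h).1]; exact (hpos t h).2.1
    · have := hpos (-t) (by linarith)
      rw [hΦneg] at this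
      rw [abs_of_nonpos h, abs_of_nonpos (by linarith)]; exact this.2.1
  · rcases le_total 0 t with h | h
    · rw [abs_of_nonneg h, abs_of_nonneg (hpos t h).1]; exact (hpos t h).2.2
    · have := hpos (-t) (by linarith)
      rw [hΦneg] at this
      rw [abs_of_nonpos h, abs_of_nonpos (by linarith)]; exact this.2.2

/-! ### Energy inequality -/

/-- Testing with a truncation of the solution. -/
lemma energy_inequality {N : ℕ} (hN : 2 ≤ N) {v : Amb N → ℝ} {u B : Bdry N → ℝ} {m : ℝ}
    (hv : MemH1 v) (hu : IsTrace v u)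
    (heq : ∀ φ : Amb N → ℝ, MemH1 φ →
      ∫ z, (dot (weakGrad v z) (weakGrad φ z) + m ^ 2 * v z * φ z) ∂(halfMeasure N) =
        ∫ y, B y * trace φ y)
    {k δ : ℝ} {Φ : ℝ → ℝ} (hΦ : IsTruncation k δ Φ) :
    (∫ z, dot (weakGrad (fun z => Φ (v z)) z) (weakGrad (fun z => Φ (v z)) z) ∂(halfMeasure N)) +
      m ^ 2 * ∫ z, v z * Φ (v z) ∂(halfMeasure N) ≤ ∫ y, B y * Φ (u y) := by
  obtain ⟨hw, hgrad, htr⟩ := hu.comp hv hΦ.smooth hΦ.zero fun t => by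
    rw [abs_of_nonneg (hΦ.deriv_nonneg t)]; exact hΦ.deriv_le_one t
  have h1 := heq _ hw
  have h2 : ∫ y, B y * trace (fun z => Φ (v z)) y = ∫ y, B y * Φ (u y) := by
    refine integral_congr_ae ?_
    filter_upwards [htr.trace_ae_eq hN hw] with y hy
    rw [hy]
  have hi : Integrable (fun z => v z * Φ (v z)) (halfMeasure N) := hv.1.integrable_mul hw.1
  rw [← h2, ← h1, ← integral_const_mul, ← integral_add
    (integrable_dot hw.isWeakGrad.1 hw.isWeakGrad.1) (hi.const_mul _)]
  refine integral_mono_ae ((integrable_dot hw.isWeakGrad.1 hw.isWeakGrad.1).add (hi.const_mul _))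
    ((integrable_dot hv.isWeakGrad.1 hw.isWeakGrad.1).add ?_) ?_
  · simpa only [mul_assoc] using hi.const_mul (m ^ 2)
  · filter_upwards [hgrad] with z hz
    rw [hz]
    change dot _ _ + _ ≤ dot _ _ + _
    rw [dot_smul_left, dot_smul_right]
    have := mul_le_of_le_one_left (mul_nonneg (hΦ.deriv_nonneg (v z))
      (dot_self_nonneg (weakGrad v z))) (hΦ.deriv_le_one (v z))
    linarith

/-! ### De Giorgi iteration -/

/-- Superlinear recursive inequalities force geometric decay from small initial values. -/
lemma geometric_decay {a : ℕ → ℝ} {b R η : ℝ} (ha : ∀ n, 0 ≤ a n) (hb : 0 ≤ b) (hR : 0 < R)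
    (hη : 0 < η) (h : ∀ n, a (n + 1) ≤ b * R ^ n * a n ^ (1 + η))
    (h0 : b * a 0 ^ η ≤ R ^ (-1 / η)) (n : ℕ) : a n ≤ a 0 * (R ^ (-1 / η)) ^ n := by
  set ρ := R ^ (-1 / η) with hρ
  have hρ0 : 0 < ρ := Real.rpow_pos_of_pos hR _
  have hρη : R * ρ ^ η = 1 := by
    rw [hρ, ← Real.rpow_mul hR.le, div_mul_cancel₀ _ hη.ne', Real.rpow_neg_one,
      mul_inv_cancel₀ hR.ne']
  induction n with
  | zero => simp
  | succ n ih =>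
    have h1 : a n ^ (1 + η) ≤ (a 0 * ρ ^ n) ^ (1 + η) :=
      Real.rpow_le_rpow (ha n) ih (by linarith)
    have h2 : (a 0 * ρ ^ n) ^ (1 + η) = a 0 * ρ ^ n * (a 0 ^ η * (ρ ^ η) ^ n) := by
      have h3 : 0 ≤ a 0 * ρ ^ n := mul_nonneg (ha 0) (by positivity)
      rw [Real.rpow_add_of_nonneg h3 (by norm_num) hη.le, Real.rpow_one,
        Real.mul_rpow (ha 0) (by positivity), ← Real.rpow_natCast, ← Real.rpow_natCast,
        ← Real.rpow_mul hρ0.le, ← Real.rpow_mul hρ0.le, mul_comm (n : ℝ) η]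
    have h4 : R ^ n * (ρ ^ η) ^ n = 1 := by rw [← mul_pow, hρη, one_pow]
    calc a (n + 1) ≤ b * R ^ n * (a 0 * ρ ^ n * (a 0 ^ η * (ρ ^ η) ^ n)) := by
          rw [← h2]; exact (h n).trans (mul_le_mul_of_nonneg_left h1 (by positivity))
      _ = (b * a 0 ^ η) * (a 0 * ρ ^ n) * (R ^ n * (ρ ^ η) ^ n) := by ring
      _ ≤ ρ * (a 0 * ρ ^ n) := by
          rw [h4, mul_one]
          exact mul_le_mul_of_nonneg_right h0 (mul_nonneg (ha 0) (by positivity))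
      _ = _ := by ring

section Levels

variable {α : Type*} [MeasurableSpace α] {μ : Measure α}

/-- Hölder's inequality on a set `A` with `μ A ≤ 1`, for a function in `L^∞ + L^q`. -/
lemma eLpNorm_restrict_le {g : α → ℝ} {c p q : ℝ} (hp : 1 ≤ p) (hpq : p ≤ q)
    (hg : AEStronglyMeasurable g μ) {A : Set α} (hA : μ A ≤ 1) :
    eLpNorm (fun y => c + |g y|) (ENNReal.ofReal p) (μ.restrict A) ≤
      (‖c‖ₑ + eLpNorm g (ENNReal.ofReal q) μ) * μ A ^ (1 / p - 1 / q) := by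
  have hq0 : ENNReal.ofReal q ≠ 0 := by simp; linarith
  have hm : AEStronglyMeasurable (fun y => c + |g y|) (μ.restrict A) :=
    aestronglyMeasurable_const.add hg.restrict.norm
  have h1 := eLpNorm_le_eLpNorm_mul_rpow_measure_univ (ENNReal.ofReal_le_ofReal hpq) hm
  rw [Measure.restrict_apply_univ, ENNReal.toReal_ofReal (by linarith),
    ENNReal.toReal_ofReal (by linarith)] at h1
  refine h1.trans ?_
  gcongr
  refine (eLpNorm_add_le aestronglyMeasurable_const hg.restrict.norm
    (by rw [← ENNReal.ofReal_one]; exact ENNReal.ofReal_le_ofReal (by linarith))).trans ?_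
  gcongr
  · rw [eLpNorm_const' _ hq0 ENNReal.ofReal_ne_top, Measure.restrict_apply_univ]
    exact mul_le_of_le_one_right' (ENNReal.rpow_le_one hA (by positivity))
  · exact (eLpNorm_norm (g)).le.trans (eLpNorm_mono_measure _ Measure.restrict_le_self)

/-- One step of the De Giorgi iteration. -/
lemma level_step {u w g : α → ℝ} {c N q s k δ : ℝ} {C K : ℝ≥0∞} (hN : 1 < N) (hq : N ≤ q)
    (hs : s = 2 * N / (N - 1)) (hk : 0 < k) (hδk : δ ≤ k) (hc : 0 ≤ c)
    (hu : AEStronglyMeasurable u μ) (hw : AEStronglyMeasurable w μ)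
    (hg : AEStronglyMeasurable g μ) (hK : ‖c‖ₑ + eLpNorm g (ENNReal.ofReal q) μ ≤ K)
    (hw0 : ∀ y, |u y| ≤ k → w y = 0) (hw1 : ∀ y, |u y| - k - δ ≤ |w y|)
    (hwfin : eLpNorm w (ENNReal.ofReal s) μ ≠ ⊤)
    (hA : μ {y | k < |u y|} ≤ 1)
    (hsmall : 2 * (C * K) * μ {y | k < |u y|} ^ (1 / N - 1 / q) ≤ 2⁻¹)
    (hE : eLpNorm w (ENNReal.ofReal s) μ ^ 2 ≤
      C * ∫⁻ y, ENNReal.ofReal ((c + |g y|) * |u y| * |w y|) ∂μ) :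
    ENNReal.ofReal δ ^ 2 * μ {y | k + 2 * δ < |u y|} ^ (2 / s) ≤
      2 * (C * K) * ENNReal.ofReal (k ^ 2) * μ {y | k < |u y|} ^ (1 - 1 / q) := by
  set A := {y | k < |u y|} with hAdef
  set X := eLpNorm w (ENNReal.ofReal s) μ ^ 2 with hX
  have hN0 : N - 1 ≠ 0 := by linarith
  have hs0 : 0 < s := by rw [hs]; exact div_pos (by linarith) (by linarith)
  have hAm : NullMeasurableSet A μ := nullMeasurableSet_lt aemeasurable_const hu.norm.aemeasurable
  have hs' : ENNReal.ofReal s ≠ 0 := by simpa using hs0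
  have hwint : ∫⁻ y, ‖w y‖ₑ ^ s ∂μ = eLpNorm w (ENNReal.ofReal s) μ ^ s := by
    rw [eLpNorm_eq_lintegral_rpow_enorm_toReal hs' ENNReal.ofReal_ne_top,
      ENNReal.toReal_ofReal hs0.le, ← ENNReal.rpow_mul, one_div_mul_cancel hs0.ne',
      ENNReal.rpow_one]
  -- the right-hand side lives on `A`, where `|u| ≤ |w| + 2k`
  have h1 : ∫⁻ y, ENNReal.ofReal ((c + |g y|) * |u y| * |w y|) ∂μ ≤
      ∫⁻ y in A, (2 * (ENNReal.ofReal (c + |g y|) * ‖w y‖ₑ ^ (2 : ℝ)) +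
        ENNReal.ofReal (k ^ 2) * ENNReal.ofReal (c + |g y|)) ∂μ := by
    have e : ∫⁻ y, ENNReal.ofReal ((c + |g y|) * |u y| * |w y|) ∂μ =
        ∫⁻ y in A, ENNReal.ofReal ((c + |g y|) * |u y| * |w y|) ∂μ := by
      rw [← lintegral_indicator₀ hAm]
      refine lintegral_congr fun y => ?_
      by_cases hy : y ∈ A
      · rw [indicator_of_mem hy]
      · rw [indicator_of_notMem hy, hw0 y (not_lt.1 hy)]; simp
    rw [e]
    refine lintegral_mono fun y => ?_
    have hG : 0 ≤ c + |g y| := by positivity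
    have e2 : ‖w y‖ₑ ^ (2 : ℝ) = ENNReal.ofReal (|w y| ^ 2) := by
      rw [← ofReal_norm, Real.norm_eq_abs, ENNReal.ofReal_pow (abs_nonneg _)]; norm_num
    have e3 : (2 : ℝ≥0∞) = ENNReal.ofReal 2 := by simp
    beta_reduce
    rw [e2]
    nth_rewrite 1 [e3]
    rw [← ENNReal.ofReal_mul hG, ← ENNReal.ofReal_mul (by norm_num),
      ← ENNReal.ofReal_mul (by positivity), ← ENNReal.ofReal_add (by positivity) (by positivity)]
    refine ENNReal.ofReal_le_ofReal ?_
    have h3 : |u y| ≤ |w y| + 2 * k := by linarith [hw1 y]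
    have h4 : |u y| * |w y| ≤ 2 * |w y| ^ 2 + k ^ 2 :=
      (mul_le_mul_of_nonneg_right h3 (abs_nonneg _)).trans (by nlinarith [sq_nonneg (|w y| - k)])
    calc (c + |g y|) * |u y| * |w y| = (c + |g y|) * (|u y| * |w y|) := by ring
      _ ≤ (c + |g y|) * (2 * |w y| ^ 2 + k ^ 2) := mul_le_mul_of_nonneg_left h4 hG
      _ = _ := by ring
  have hGm : AEMeasurable (fun y => ENNReal.ofReal (c + |g y|)) (μ.restrict A) :=
    (aemeasurable_const.add hg.restrict.norm.aemeasurable).ennreal_ofReal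
  have hwm : AEMeasurable (fun y => ‖w y‖ₑ ^ (2 : ℝ)) (μ.restrict A) :=
    hw.restrict.enorm.pow_const _
  have hen : ∀ y, ‖c + |g y|‖ₑ = ENNReal.ofReal (c + |g y|) := fun y => by
    rw [← ofReal_norm, Real.norm_of_nonneg (by positivity)]
  have h2 : ∫⁻ y in A, ENNReal.ofReal (c + |g y|) * ‖w y‖ₑ ^ (2 : ℝ) ∂μ ≤
      K * μ A ^ (1 / N - 1 / q) * X := by
    have hconj : N.HolderConjugate (N / (N - 1)) := Real.HolderConjugate.conjExponent hN
    have := ENNReal.lintegral_mul_le_Lp_mul_Lq (μ.restrict A) hconj hGm hwm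
    simp only [Pi.mul_apply] at this
    refine this.trans ?_
    gcongr
    · have hh := eLpNorm_restrict_le (c := c) hN.le hq hg hA
      rw [eLpNorm_eq_lintegral_rpow_enorm_toReal (by simp; linarith) ENNReal.ofReal_ne_top,
        ENNReal.toReal_ofReal (by linarith)] at hh
      simp only [hen] at hh
      exact hh.trans (mul_le_mul_left hK _)
    · have e5 : ∀ y, (‖w y‖ₑ ^ (2 : ℝ)) ^ (N / (N - 1)) = ‖w y‖ₑ ^ s := fun y => by
        rw [← ENNReal.rpow_mul, hs]; congr 1; ring
      simp only [e5]
      calc (∫⁻ y in A, ‖w y‖ₑ ^ s ∂μ) ^ (1 / (N / (N - 1)))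
          ≤ (∫⁻ y, ‖w y‖ₑ ^ s ∂μ) ^ (1 / (N / (N - 1))) :=
            ENNReal.rpow_le_rpow (setLIntegral_le_lintegral _ _)
              (one_div_nonneg.2 (div_nonneg (by linarith) (by linarith)))
        _ = X := by
          rw [hwint, ← ENNReal.rpow_mul, hX, ← ENNReal.rpow_natCast]
          congr 1
          rw [hs]; field_simp; norm_num
  have h3 : ∫⁻ y in A, ENNReal.ofReal (c + |g y|) ∂μ ≤ K * μ A ^ (1 - 1 / q) := by
    have hh := eLpNorm_restrict_le (c := c) le_rfl (hN.le.trans hq) hg hA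
    rw [ENNReal.ofReal_one, eLpNorm_one_eq_lintegral_enorm, one_div_one] at hh
    simp only [hen] at hh
    exact hh.trans (mul_le_mul_left hK _)
  have hXfin : X ≠ ⊤ := ENNReal.pow_ne_top hwfin
  set Y := C * (ENNReal.ofReal (k ^ 2) * (K * μ A ^ (1 - 1 / q))) with hY
  have h4 : X ≤ 2⁻¹ * X + Y := by
    refine hE.trans ?_
    calc C * ∫⁻ y, ENNReal.ofReal ((c + |g y|) * |u y| * |w y|) ∂μ
        ≤ C * (2 * (K * μ A ^ (1 / N - 1 / q) * X) +
            ENNReal.ofReal (k ^ 2) * (K * μ A ^ (1 - 1 / q))) := by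
          gcongr
          refine h1.trans ?_
          have hGw : AEMeasurable (fun y => ENNReal.ofReal (c + |g y|) * ‖w y‖ₑ ^ (2 : ℝ))
            (μ.restrict A) := hGm.mul hwm
          rw [lintegral_add_left' (hGw.const_mul _), lintegral_const_mul'' _ hGw,
            lintegral_const_mul'' _ hGm]
          gcongr
      _ = 2 * (C * K) * μ A ^ (1 / N - 1 / q) * X + Y := by rw [hY]; ring
      _ ≤ _ := by gcongr
  have h5 : X ≤ 2 * Y := by
    have h6 : 2⁻¹ * X + 2⁻¹ * X ≤ 2⁻¹ * X + Y := by
      rwa [← add_mul, ENNReal.inv_two_add_inv_two, one_mul]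
    have h7 := (ENNReal.add_le_add_iff_left (ENNReal.mul_ne_top (by simp) hXfin)).1 h6
    calc X = 2 * (2⁻¹ * X) := by
          rw [← mul_assoc, ENNReal.mul_inv_cancel (by norm_num) (by norm_num), one_mul]
      _ ≤ 2 * Y := by gcongr
  refine le_trans ?_ (h5.trans (le_of_eq (by rw [hY]; ring)))
  -- Chebyshev
  have hcheb : ENNReal.ofReal δ ^ s * μ {y | k + 2 * δ < |u y|} ≤ ∫⁻ y, ‖w y‖ₑ ^ s ∂μ := by
    refine le_trans (mul_le_mul' le_rfl (measure_mono fun y hy => ?_))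
      (mul_meas_ge_le_lintegral₀ (hw.enorm.pow_const _) (ENNReal.ofReal δ ^ s))
    simp only [mem_ofPred_eq] at hy ⊢
    rw [← ofReal_norm, Real.norm_eq_abs]
    exact ENNReal.rpow_le_rpow (ENNReal.ofReal_le_ofReal (by linarith [hw1 y])) hs0.le
  have := ENNReal.rpow_le_rpow hcheb (show 0 ≤ 2 / s by positivity)
  rw [hwint, ENNReal.mul_rpow_of_nonneg _ _ (by positivity), ← ENNReal.rpow_mul,
    ← ENNReal.rpow_mul, mul_div_cancel₀ _ hs0.ne'] at this
  simpa [hX] using this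

lemma tendsto_measure_level {u : α → ℝ} (hu : MemLp u 2 μ) :
    Tendsto (fun k : ℝ => (μ {y | k < |u y|}).toReal) atTop (𝓝 0) := by
  have hb : ∀ k : ℝ, 0 < k → (μ {y | k < |u y|}).toReal ≤
      (eLpNorm u 2 μ ^ 2).toReal / k ^ 2 := fun k hk => by
    have h := mul_meas_ge_le_pow_eLpNorm' μ (p := 2) (by norm_num) (by norm_num)
      hu.aestronglyMeasurable (ENNReal.ofReal k)
    simp only [ENNReal.toReal_ofNat, ENNReal.rpow_ofNat] at h
    have h1 : ENNReal.ofReal k ^ 2 * μ {y | k < |u y|} ≤ eLpNorm u 2 μ ^ 2 := by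
      refine le_trans (mul_le_mul' le_rfl (measure_mono fun y hy => ?_)) h
      rw [mem_ofPred_eq, ← ofReal_norm]
      exact ENNReal.ofReal_le_ofReal (le_of_lt hy)
    have h2 := ENNReal.toReal_mono (ENNReal.pow_ne_top hu.eLpNorm_ne_top) h1
    rw [ENNReal.toReal_mul, ENNReal.toReal_pow, ENNReal.toReal_ofReal hk.le] at h2
    rw [le_div_iff₀ (by positivity)]; linarith
  refine squeeze_zero' (Eventually.of_forall fun _ => ENNReal.toReal_nonneg)
    ((eventually_gt_atTop 0).mono hb) ?_
  exact tendsto_const_nhds.div_atTop (tendsto_pow_atTop two_ne_zero)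

lemma measure_level_ne_top {u : α → ℝ} (hu : MemLp u 2 μ) {k : ℝ} (hk : 0 < k) :
    μ {y | k < |u y|} ≠ ⊤ := by
  have h := mul_meas_ge_le_pow_eLpNorm' μ (p := 2) (by norm_num) (by norm_num)
      hu.aestronglyMeasurable (ENNReal.ofReal k)
  have h1 : μ {y | k < |u y|} ≤ μ {y | ENNReal.ofReal k ≤ ‖u y‖ₑ} := by
    refine measure_mono fun y hy => ?_
    rw [mem_ofPred_eq, ← ofReal_norm]
    exact ENNReal.ofReal_le_ofReal (le_of_lt hy)
  intro htop
  rw [htop, top_le_iff] at h1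
  rw [h1, ENNReal.mul_top (by simpa using hk)] at h
  exact absurd (top_le_iff.1 h) (ENNReal.rpow_ne_top_of_nonneg (by simp) hu.eLpNorm_ne_top)

/-- A function whose truncations satisfy a subcritical energy estimate is bounded. -/
lemma exists_bound_of_energy {u g : α → ℝ} {c N q s : ℝ} {C : ℝ≥0} (hN : 1 < N) (hq : N < q)
    (hs : s = 2 * N / (N - 1)) (hc : 0 ≤ c) (hu : MemLp u 2 μ)
    (hus : MemLp u (ENNReal.ofReal s) μ) (hg : MemLp g (ENNReal.ofReal q) μ)
    (hE : ∀ k δ : ℝ, 0 < k → 0 < δ → ∀ Φ, IsTruncation k δ Φ →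
      eLpNorm (fun y => Φ (u y)) (ENNReal.ofReal s) μ ^ 2 ≤
        C * ∫⁻ y, ENNReal.ofReal ((c + |g y|) * |u y| * |Φ (u y)|) ∂μ) :
    ∃ M : ℝ, 0 < M ∧ ∀ᵐ y ∂μ, |u y| ≤ M := by
  have hN0 : 0 < N - 1 := by linarith
  have hs0 : 0 < s := by rw [hs]; exact div_pos (by linarith) hN0
  have hq0 : 0 < q := by linarith
  obtain ⟨K, hK⟩ : ∃ K : ℝ≥0, ‖c‖ₑ + eLpNorm g (ENNReal.ofReal q) μ = K :=
    ⟨_, (ENNReal.coe_toNNReal (ENNReal.add_ne_top.2 ⟨by simp, hg.eLpNorm_ne_top⟩)).symm⟩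
  set a : ℝ → ℝ := fun k => (μ {y | k < |u y|}).toReal with ha
  have ha0 : ∀ k, 0 ≤ a k := fun k => ENNReal.toReal_nonneg
  have hlim : Tendsto a atTop (𝓝 0) := tendsto_measure_level hu
  set L : ℝ := 2 * (C * K) with hL
  have hL0 : 0 ≤ L := by positivity
  set σ : ℝ := N / (N - 1) with hσ
  have hσ0 : 0 < σ := div_pos (by linarith) hN0
  set η : ℝ := (1 - 1 / q) * σ - 1 with hη
  have hη0 : 0 < η := by
    have h1 : 1 / q < 1 / N := one_div_lt_one_div_of_lt (by linarith) hq
    have h2 : (1 - 1 / N) * σ = 1 := by rw [hσ]; field_simp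
    have : (1 - 1 / N) * σ < (1 - 1 / q) * σ := mul_lt_mul_of_pos_right (by linarith) hσ0
    linarith
  set b : ℝ := (64 * L) ^ σ with hb
  set R : ℝ := 4 ^ σ with hR
  have hR0 : 0 < R := by positivity
  have hε : 0 < 1 / N - 1 / q := sub_pos.2 (one_div_lt_one_div_of_lt (by linarith) hq)
  have t1 : ∀ᶠ k in atTop, L * a k ^ (1 / N - 1 / q) < 2⁻¹ := by
    have := (hlim.rpow_const (p := 1 / N - 1 / q) (Or.inr hε.le)).const_mul L
    rw [Real.zero_rpow hε.ne', mul_zero] at this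
    exact this.eventually_lt_const (by norm_num)
  have t2 : ∀ᶠ k in atTop, b * a k ^ η < R ^ (-1 / η) := by
    have := (hlim.rpow_const (p := η) (Or.inr hη0.le)).const_mul b
    rw [Real.zero_rpow hη0.ne', mul_zero] at this
    exact this.eventually_lt_const (Real.rpow_pos_of_pos hR0 _)
  have t3 : ∀ᶠ k in atTop, a k < 1 := hlim.eventually_lt_const one_pos
  obtain ⟨k₀, ⟨⟨h1, h2⟩, h3⟩, hk₀⟩ := (((t1.and t2).and t3).and (eventually_gt_atTop 0)).exists
  have hfin : ∀ k, 0 < k → μ {y | k < |u y|} = ENNReal.ofReal (a k) := fun k hk =>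
    (ENNReal.ofReal_toReal (measure_level_ne_top hu hk)).symm
  have hanti : ∀ k, k₀ ≤ k → a k ≤ a k₀ := fun k hk =>
    ENNReal.toReal_mono (measure_level_ne_top hu hk₀)
      (measure_mono fun y (hy : k < |u y|) => show k₀ < |u y| by linarith)
  have step : ∀ k δ : ℝ, k₀ ≤ k → 0 < δ → δ ≤ k →
      δ ^ 2 * a (k + 2 * δ) ^ (2 / s) ≤ L * k ^ 2 * a k ^ (1 - 1 / q) := by
    intro k δ hk hδ hδk
    have hk0 : 0 < k := by linarith
    obtain ⟨Φ, hΦ⟩ := exists_isTruncation hk0 hδ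
    have hm : AEStronglyMeasurable (fun y => Φ (u y)) μ :=
      hΦ.smooth.continuous.comp_aestronglyMeasurable hu.aestronglyMeasurable
    have hLe : 2 * ((C : ℝ≥0∞) * K) = ENNReal.ofReal L := by
      rw [hL, ENNReal.ofReal_mul (by norm_num), ENNReal.ofReal_mul (by positivity)]; simp
    have hexp : 0 ≤ 1 - 1 / q := by
      rw [sub_nonneg, div_le_one hq0]; linarith
    have := level_step (w := fun y => Φ (u y)) (C := C) (K := K) hN hq.le hs hk0 hδk hc
      hu.aestronglyMeasurable hm hg.aestronglyMeasurable hK.le (fun y hy => hΦ.eq_zero _ hy)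
      (fun y => hΦ.le_abs _)
      (hus.of_le hm (Eventually.of_forall fun y => hΦ.abs_le _)).eLpNorm_ne_top
      (by rw [hfin k hk0, ENNReal.ofReal_le_one]; linarith [hanti k hk])
      (by
        rw [hLe, hfin k hk0, ENNReal.ofReal_rpow_of_nonneg (ha0 k) hε.le,
          ← ENNReal.ofReal_mul hL0]
        have : (2 : ℝ≥0∞)⁻¹ = ENNReal.ofReal 2⁻¹ := by
          rw [ENNReal.ofReal_inv_of_pos two_pos]; simp
        rw [this]
        refine ENNReal.ofReal_le_ofReal (le_trans ?_ h1.le)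
        gcongr
        exact hanti k hk)
      (hE k δ hk0 hδ Φ hΦ)
    rw [hLe, hfin k hk0, hfin (k + 2 * δ) (by linarith),
      ENNReal.ofReal_rpow_of_nonneg (ha0 _) (by positivity),
      ENNReal.ofReal_rpow_of_nonneg (ha0 _) hexp,
      ← ENNReal.ofReal_pow hδ.le, ← ENNReal.ofReal_mul (by positivity),
      ← ENNReal.ofReal_mul hL0, ← ENNReal.ofReal_mul (by positivity)] at this
    exact (ENNReal.ofReal_le_ofReal_iff
      (mul_nonneg (by positivity) (Real.rpow_nonneg (ha0 _) _))).1 this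
  set κ : ℕ → ℝ := fun n => k₀ * (2 - (1 / 2) ^ n) with hκ
  have hpow : ∀ n : ℕ, (0 : ℝ) < (1 / 2) ^ n ∧ ((1 : ℝ) / 2) ^ n ≤ 1 := fun n =>
    ⟨by positivity, pow_le_one₀ (by norm_num) (by norm_num)⟩
  have hκ1 : ∀ n, k₀ ≤ κ n ∧ κ n ≤ 2 * k₀ := fun n => by
    constructor <;> simp only [hκ] <;> nlinarith [hpow n]
  have hrec : ∀ n, a (κ (n + 1)) ≤ b * R ^ n * a (κ n) ^ (1 + η) := by
    intro n
    set δ := k₀ * (1 / 2) ^ n / 4 with hδ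
    have hδ0 : 0 < δ := div_pos (mul_pos hk₀ (hpow n).1) (by norm_num)
    have hδk : δ ≤ κ n := by simp only [hκ, hδ]; nlinarith [hpow n]
    have e1 : κ n + 2 * δ = κ (n + 1) := by simp only [hκ, hδ, pow_succ]; ring
    have h5 := step (κ n) δ (hκ1 n).1 hδ0 hδk
    rw [e1] at h5
    have h6 : a (κ (n + 1)) ^ (2 / s) ≤ 64 * L * 4 ^ n * a (κ n) ^ (1 - 1 / q) := by
      have hz : 0 ≤ a (κ n) ^ (1 - 1 / q) := Real.rpow_nonneg (ha0 _) _
      have h7 : κ n ^ 2 ≤ 4 * k₀ ^ 2 := by nlinarith [hκ1 n]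
      have h8 : δ ^ 2 * (64 * 4 ^ n) = 4 * k₀ ^ 2 := by
        have h9 : (((1 : ℝ) / 2) ^ n) ^ 2 * 4 ^ n = 1 := by
          rw [← pow_mul, mul_comm n 2, pow_mul, ← mul_pow]; norm_num
        rw [hδ]; linear_combination (4 * k₀ ^ 2) * h9
      have h10 : δ ^ 2 * a (κ (n + 1)) ^ (2 / s) ≤
          δ ^ 2 * (64 * L * 4 ^ n * a (κ n) ^ (1 - 1 / q)) := by
        calc _ ≤ L * κ n ^ 2 * a (κ n) ^ (1 - 1 / q) := h5
          _ ≤ L * (4 * k₀ ^ 2) * a (κ n) ^ (1 - 1 / q) := by gcongr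
          _ = _ := by rw [← h8]; ring
      exact le_of_mul_le_mul_left h10 (by positivity)
    have h11 := Real.rpow_le_rpow (Real.rpow_nonneg (ha0 _) _) h6 hσ0.le
    have e2 : 2 / s * σ = 1 := by rw [hs, hσ]; field_simp
    rw [← Real.rpow_mul (ha0 _), e2, Real.rpow_one,
      Real.mul_rpow (by positivity) (Real.rpow_nonneg (ha0 _) _),
      Real.mul_rpow (by positivity) (by positivity), ← Real.rpow_mul (ha0 _)] at h11
    refine h11.trans (le_of_eq ?_)
    rw [hb, hR, hη, ← Real.rpow_natCast (4 ^ σ), ← Real.rpow_mul (by norm_num),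
      ← Real.rpow_natCast 4, ← Real.rpow_mul (by norm_num)]
    congr 2
    · rw [mul_comm]
    · ring
  have hκ0 : κ 0 = k₀ := by simp only [hκ]; norm_num
  have hdecay := geometric_decay (a := fun n => a (κ n)) (fun n => ha0 _) (by positivity) hR0 hη0
    hrec (by rw [hκ0]; exact h2.le)
  have hρ1 : R ^ (-1 / η) < 1 :=
    Real.rpow_lt_one_of_one_lt_of_neg (Real.one_lt_rpow (by norm_num) hσ0)
      (div_neg_of_neg_of_pos (by norm_num) hη0)
  have hzero : a (2 * k₀) = 0 := by
    refine le_antisymm ?_ (ha0 _)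
    have hl : Tendsto (fun n : ℕ => a (κ 0) * (R ^ (-1 / η)) ^ n) atTop (𝓝 0) := by
      simpa using (tendsto_pow_atTop_nhds_zero_of_lt_one (Real.rpow_nonneg hR0.le _) hρ1).const_mul
        (a (κ 0))
    refine ge_of_tendsto' hl fun n => le_trans ?_ (hdecay n)
    exact ENNReal.toReal_mono (measure_level_ne_top hu (by linarith [hκ1 n]))
      (measure_mono fun y (hy : 2 * k₀ < |u y|) => show κ n < |u y| by linarith [hκ1 n])
  refine ⟨2 * k₀, by linarith, ?_⟩
  have := hfin (2 * k₀) (by linarith)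
  rw [hzero, ENNReal.ofReal_zero] at this
  simpa [ae_iff] using this

end Levels

/-! ### Boundedness for the linear boundary problem -/

/-- Solutions of `-Δv + m²v = 0`, `-∂v/∂x = B` with `|B| ≤ (c + |g|) |u|`, `g ∈ L^q`, `q > N`, are
bounded, together with their traces. -/
lemma exists_bound_of_weak_equation {N : ℕ} (hN : 2 ≤ N) {v : Amb N → ℝ} {u B g : Bdry N → ℝ}
    {m c q : ℝ} (hm : 0 < m) (hv : MemH1 v) (hu : IsTrace v u)
    (heq : ∀ φ : Amb N → ℝ, MemH1 φ →
      ∫ z, (dot (weakGrad v z) (weakGrad φ z) + m ^ 2 * v z * φ z) ∂(halfMeasure N) =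
        ∫ y, B y * trace φ y)
    (hc : 0 ≤ c) (hq : (N : ℝ) < q) (hg : MemLp g (ENNReal.ofReal q) volume)
    (hB : ∀ᵐ y, |B y| ≤ (c + |g y|) * |u y|) :
    ∃ M : ℝ, (∀ᵐ y, |u y| ≤ M) ∧ ∀ᵐ z ∂(halfMeasure N), |v z| ≤ M := by
  have hN' : (2 : ℝ) ≤ N := by exact_mod_cast hN
  have hs0 : (0 : ℝ) < 2 * N / (N - 1) := div_pos (by linarith) (by linarith)
  obtain ⟨s, hs⟩ : ∃ s : ℝ≥0, (s : ℝ) = 2 * N / (N - 1) := ⟨⟨_, hs0.le⟩, rfl⟩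
  obtain ⟨C, hC⟩ := exists_trace_bound N hN hs
  have hsc : ENNReal.ofReal (s : ℝ) = s := ENNReal.ofReal_coe_nnreal
  have hvw : ∀ k δ Φ, IsTruncation k δ Φ → 0 ≤ ∫ z, v z * Φ (v z) ∂(halfMeasure N) :=
    fun k δ Φ hΦ => integral_nonneg fun z => hΦ.mul_nonneg _
  obtain ⟨M, hM, hMu⟩ := exists_bound_of_energy (u := u) (g := g) (C := C ^ 2)
    (μ := (volume : Measure (Bdry N))) (by linarith : (1 : ℝ) < N) hq hs hc hu.1
    (hsc ▸ ⟨hu.1.aestronglyMeasurable, (hC v u hv hu).trans_lt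
      (ENNReal.mul_lt_top ENNReal.coe_lt_top ENNReal.ofReal_lt_top)⟩) hg (by
    intro k δ hk hδ Φ hΦ
    obtain ⟨hw, hgrad, htr⟩ := hu.comp hv hΦ.smooth hΦ.zero fun t => by
      rw [abs_of_nonneg (hΦ.deriv_nonneg t)]; exact hΦ.deriv_le_one t
    have hE := energy_inequality hN hv hu heq hΦ
    have hI := integral_nonneg (μ := halfMeasure N) (f := fun z =>
      dot (weakGrad (fun z => Φ (v z)) z) (weakGrad (fun z => Φ (v z)) z))
      fun z => dot_self_nonneg _
    rw [hsc]
    calc _ ≤ (C * ENNReal.ofReal √(∫ z, dot (weakGrad (fun z => Φ (v z)) z)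
            (weakGrad (fun z => Φ (v z)) z) ∂(halfMeasure N))) ^ 2 := by
          gcongr; exact hC _ _ hw htr
      _ = (C ^ 2 : ℝ≥0) * ENNReal.ofReal (∫ z, dot (weakGrad (fun z => Φ (v z)) z)
            (weakGrad (fun z => Φ (v z)) z) ∂(halfMeasure N)) := by
          rw [mul_pow, ← ENNReal.ofReal_pow (Real.sqrt_nonneg _), Real.sq_sqrt hI, ENNReal.coe_pow]
      _ ≤ _ := by
          gcongr
          have h1 : ENNReal.ofReal (∫ z, dot (weakGrad (fun z => Φ (v z)) z)
              (weakGrad (fun z => Φ (v z)) z) ∂(halfMeasure N)) ≤ ‖∫ y, B y * Φ (u y)‖ₑ := by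
            rw [← ofReal_norm]
            refine ENNReal.ofReal_le_ofReal (le_trans ?_ (le_abs_self _))
            linarith [mul_nonneg (sq_nonneg m) (hvw k δ Φ hΦ)]
          refine h1.trans ((enorm_integral_le_lintegral_enorm _).trans (lintegral_mono_ae ?_))
          filter_upwards [hB] with y hy
          rw [← ofReal_norm, norm_mul]
          exact ENNReal.ofReal_le_ofReal (mul_le_mul_of_nonneg_right hy (abs_nonneg _)))
  refine ⟨M + 1, hMu.mono fun y hy => by linarith, ?_⟩
  obtain ⟨Φ, hΦ⟩ := exists_isTruncation hM one_pos
  obtain ⟨hw, -, -⟩ := hu.comp hv hΦ.smooth hΦ.zero fun t => by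
    rw [abs_of_nonneg (hΦ.deriv_nonneg t)]; exact hΦ.deriv_le_one t
  have hE := energy_inequality hN hv hu heq hΦ
  have h0 : ∫ y, B y * Φ (u y) = 0 := by
    rw [← integral_zero (Bdry N) ℝ]
    refine integral_congr_ae ?_
    filter_upwards [hMu] with y hy
    rw [hΦ.eq_zero _ hy, mul_zero]
  have hI := integral_nonneg (μ := halfMeasure N) (f := fun z =>
      dot (weakGrad (fun z => Φ (v z)) z) (weakGrad (fun z => Φ (v z)) z))
      fun z => dot_self_nonneg _
  have h1 : ∫ z, v z * Φ (v z) ∂(halfMeasure N) = 0 := by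
    refine le_antisymm ?_ (hvw _ _ _ hΦ)
    by_contra! hpos
    linarith [mul_pos (pow_pos hm 2) hpos]
  have h2 := (integral_eq_zero_iff_of_nonneg (fun z => hΦ.mul_nonneg (v z))
    (hv.1.integrable_mul hw.1)).1 h1
  filter_upwards [h2] with z hz
  by_contra! hlt
  have h3 := hΦ.le_abs (v z)
  have h4 : Φ (v z) ≠ 0 := fun h => by rw [h, abs_zero] at h3; linarith
  have h5 : v z ≠ 0 := fun h => by rw [h, abs_zero] at hlt; linarith
  exact mul_ne_zero h5 h4 hz

/-! ### Lebesgue spaces with real exponents -/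

section Lebesgue

variable {α : Type*} [MeasurableSpace α] {μ : Measure α} {u : α → ℝ}

lemma memLp_ofReal_iff {t : ℝ} (ht : 0 < t) (hu : AEStronglyMeasurable u μ) :
    MemLp u (ENNReal.ofReal t) μ ↔ Integrable (fun y => |u y| ^ t) μ := by
  have := integrable_norm_rpow_iff (p := ENNReal.ofReal t) hu (by simpa using ht)
    ENNReal.ofReal_ne_top
  rw [← this, ENNReal.toReal_ofReal ht.le]
  rfl

lemma memLp_rpow {t p : ℝ} (ht : 0 < t) (hp : 0 < p) (hu : MemLp u (ENNReal.ofReal (t * p)) μ) :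
    MemLp (fun y => |u y| ^ t) (ENNReal.ofReal p) μ := by
  have hm := hu.aestronglyMeasurable
  rw [memLp_ofReal_iff (mul_pos ht hp) hm] at hu
  have hm' : AEStronglyMeasurable (fun y => |u y| ^ t) μ :=
    (Real.continuous_rpow_const ht.le).comp_aestronglyMeasurable hm.norm
  rw [memLp_ofReal_iff hp hm']
  refine hu.congr (Eventually.of_forall fun y => ?_)
  simp only
  rw [abs_of_nonneg (Real.rpow_nonneg (abs_nonneg _) _), ← Real.rpow_mul (abs_nonneg _)]

lemma rpow_le_add_rpow {x p t q : ℝ} (hx : 0 ≤ x) (hp : 0 ≤ p) (hpt : p ≤ t) (htq : t ≤ q) :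
    x ^ t ≤ x ^ p + x ^ q := by
  rcases hx.eq_or_lt with rfl | hx'
  · rcases hp.eq_or_lt with rfl | hp'
    · rw [Real.rpow_zero]
      exact (Real.zero_rpow_le_one _).trans (by linarith [Real.zero_rpow_nonneg q])
    · rw [Real.zero_rpow (by linarith)]
      exact add_nonneg (Real.zero_rpow_nonneg _) (Real.zero_rpow_nonneg _)
  rcases le_total x 1 with h | h
  · linarith [Real.rpow_le_rpow_of_exponent_ge hx' h hpt, Real.rpow_nonneg hx q]
  · linarith [Real.rpow_le_rpow_of_exponent_le h htq, Real.rpow_nonneg hx p]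

lemma memLp_of_between {p t q : ℝ} (hp : 0 < p) (hpt : p ≤ t) (htq : t ≤ q)
    (hup : MemLp u (ENNReal.ofReal p) μ) (huq : MemLp u (ENNReal.ofReal q) μ) :
    MemLp u (ENNReal.ofReal t) μ := by
  have hm := hup.aestronglyMeasurable
  rw [memLp_ofReal_iff hp hm] at hup
  rw [memLp_ofReal_iff (by linarith) hm] at huq
  rw [memLp_ofReal_iff (by linarith) hm]
  refine (hup.add huq).mono'
    ((Real.continuous_rpow_const (by linarith)).comp_aestronglyMeasurable hm.norm)
    (Eventually.of_forall fun y => ?_)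
  rw [Real.norm_of_nonneg (Real.rpow_nonneg (abs_nonneg _) _)]
  exact rpow_le_add_rpow (abs_nonneg _) hp.le hpt htq

lemma memLp_mul {f g : α → ℝ} {p q r : ℝ} (hp : 0 < p) (hq : 0 < q) (hr : 0 < r)
    (h : 1 / p + 1 / q = 1 / r) (hf : MemLp f (ENNReal.ofReal p) μ)
    (hg : MemLp g (ENNReal.ofReal q) μ) : MemLp (fun y => f y * g y) (ENNReal.ofReal r) μ := by
  have : ENNReal.HolderTriple (ENNReal.ofReal p) (ENNReal.ofReal q) (ENNReal.ofReal r) := ⟨by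
    rw [← ENNReal.ofReal_inv_of_pos hp, ← ENNReal.ofReal_inv_of_pos hq,
      ← ENNReal.ofReal_inv_of_pos hr, ← ENNReal.ofReal_add (by positivity) (by positivity)]
    simp only [one_div] at h; rw [h]⟩
  exact hg.mul hf

/-- A bounded function in `L²` is in `L^p` for all `p ∈ [2, ∞]`. -/
lemma memLp_of_bounded {M : ℝ} (hu : MemLp u 2 μ) (hM : ∀ᵐ y ∂μ, |u y| ≤ M) {p : ℝ≥0∞}
    (hp : 2 ≤ p) : MemLp u p μ := by
  have hm := hu.aestronglyMeasurable
  rcases eq_or_ne p ⊤ with rfl | htop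
  · exact memLp_top_of_bound hm M hM
  have hp2 : 2 ≤ p.toReal := by
    simpa using ENNReal.toReal_mono htop hp
  rw [← ENNReal.ofReal_toReal htop, memLp_ofReal_iff (by linarith) hm]
  rw [show (2 : ℝ≥0∞) = ENNReal.ofReal 2 by simp, memLp_ofReal_iff two_pos hm] at hu
  refine (hu.const_mul (M ^ (p.toReal - 2))).mono'
    ((Real.continuous_rpow_const (by linarith)).comp_aestronglyMeasurable hm.norm) ?_
  filter_upwards [hM] with y hy
  rw [Real.norm_of_nonneg (Real.rpow_nonneg (abs_nonneg _) _)]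
  have e : |u y| ^ p.toReal = |u y| ^ (p.toReal - 2) * |u y| ^ (2 : ℝ) := by
    rw [← Real.rpow_add_of_nonneg (abs_nonneg _) (by linarith) (by norm_num)]; congr 1; ring
  rw [e]
  gcongr

end Lebesgue

/-! ### Young's convolution inequality -/

section Young

variable {E : Type*} [NormedAddCommGroup E] [MeasurableSpace E] [BorelSpace E]
  [SecondCountableTopology E] {μ : Measure E} [SFinite μ] [μ.IsAddLeftInvariant] [μ.IsNegInvariant]

/-- Young's inequality for the convolution of nonnegative functions. -/
lemma lintegral_convolution_rpow_le {f g : E → ℝ≥0∞} (hf : AEMeasurable f μ)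
    (hg : AEMeasurable g μ) {p r s : ℝ} (hs : 0 < s) (hr : 0 < r) (hp : 0 < p)
    (hrs : 1 / s ≤ 1 / r) (hps : 1 / s ≤ 1 / p) (h : 1 / r + 1 / p = 1 + 1 / s) :
    ∫⁻ y, (∫⁻ t, f t * g (y - t) ∂μ) ^ s ∂μ ≤
      (∫⁻ t, f t ^ r ∂μ) ^ (s / r) * (∫⁻ t, g t ^ p ∂μ) ^ (s / p) := by
  set A := ∫⁻ t, f t ^ r ∂μ with hA
  set B := ∫⁻ t, g t ^ p ∂μ with hB
  have hsub : ∀ y : E, AEMeasurable (fun t => g (y - t)) μ := fun y =>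
    hg.comp_quasiMeasurePreserving (quasiMeasurePreserving_sub_left μ y)
  have hinv : ∀ y : E, ∫⁻ t, g (y - t) ^ p ∂μ = B := fun y =>
    lintegral_sub_left_eq_self (fun t => g t ^ p) y
  have hpt : ∀ y : E, (∫⁻ t, f t * g (y - t) ∂μ) ^ s ≤
      (∫⁻ t, f t ^ r * g (y - t) ^ p ∂μ) * (A ^ (s / r - 1) * B ^ (s / p - 1)) := by
    intro y
    have hH := ENNReal.lintegral_prod_norm_pow_le (μ := μ) (Finset.univ : Finset (Fin 3))
      (f := ![fun t => f t ^ r * g (y - t) ^ p, fun t => f t ^ r, fun t => g (y - t) ^ p])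
      (p := ![1 / s, 1 / r - 1 / s, 1 / p - 1 / s])
      (fun i _ => by
        fin_cases i
        · exact (hf.pow_const _).mul ((hsub y).pow_const _)
        · exact hf.pow_const _
        · exact (hsub y).pow_const _)
      (by simp only [Fin.sum_univ_three, Matrix.cons_val]; linarith)
      (fun i _ => by
        fin_cases i
        · exact (one_div_pos.2 hs).le
        · exact sub_nonneg.2 hrs
        · exact sub_nonneg.2 hps)
    simp only [Fin.prod_univ_three, Matrix.cons_val] at hH
    rw [hinv y] at hH
    have e : ∀ t, (f t ^ r * g (y - t) ^ p) ^ (1 / s) * (f t ^ r) ^ (1 / r - 1 / s) *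
        (g (y - t) ^ p) ^ (1 / p - 1 / s) = f t * g (y - t) := fun t => by
      rw [ENNReal.mul_rpow_of_nonneg _ _ (by positivity),
        mul_right_comm ((f t ^ r) ^ (1 / s)), mul_assoc,
        ← ENNReal.rpow_add_of_nonneg _ _ (by positivity) (sub_nonneg.2 hrs),
        ← ENNReal.rpow_add_of_nonneg _ _ (by positivity) (sub_nonneg.2 hps)]
      simp only [add_sub_cancel, ← ENNReal.rpow_mul]
      rw [mul_one_div_cancel hr.ne', mul_one_div_cancel hp.ne', ENNReal.rpow_one,
        ENNReal.rpow_one]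
    simp only [e] at hH
    refine (ENNReal.rpow_le_rpow hH hs.le).trans (le_of_eq ?_)
    rw [ENNReal.mul_rpow_of_nonneg _ _ hs.le, ENNReal.mul_rpow_of_nonneg _ _ hs.le,
      ← ENNReal.rpow_mul, ← ENNReal.rpow_mul, ← ENNReal.rpow_mul, one_div_mul_cancel hs.ne',
      ENNReal.rpow_one, mul_assoc]
    congr 3
    · field_simp
    · field_simp
  have hconv : AEMeasurable (fun z : E × E => f z.2 ^ r * g (z.1 - z.2) ^ p) (μ.prod μ) :=
    (hf.comp_snd.pow_const _).mul
      ((hg.comp_quasiMeasurePreserving (quasiMeasurePreserving_sub μ μ)).pow_const _)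
  have hAB : ∫⁻ y, ∫⁻ t, f t ^ r * g (y - t) ^ p ∂μ ∂μ = A * B := by
    rw [lintegral_lintegral_swap hconv]
    have : ∀ t, ∫⁻ y, f t ^ r * g (y - t) ^ p ∂μ = f t ^ r * B := fun t => by
      have hgt : AEMeasurable (fun y => g (y - t) ^ p) μ := by
        refine AEMeasurable.pow_const ?_ _
        exact hg.comp_quasiMeasurePreserving
          (measurePreserving_sub_right μ t).quasiMeasurePreserving
      rw [lintegral_const_mul'' _ hgt, lintegral_sub_right_eq_self (fun y => g y ^ p) t]
    simp only [this]
    rw [lintegral_mul_const'' _ (hf.pow_const _)]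
  have hsr : 0 ≤ s / r - 1 := by
    rw [sub_nonneg, le_div_iff₀ hr, one_mul]; exact (one_div_le_one_div hs hr).1 hrs
  have hsp : 0 ≤ s / p - 1 := by
    rw [sub_nonneg, le_div_iff₀ hp, one_mul]; exact (one_div_le_one_div hs hp).1 hps
  calc ∫⁻ y, (∫⁻ t, f t * g (y - t) ∂μ) ^ s ∂μ
      ≤ ∫⁻ y, (∫⁻ t, f t ^ r * g (y - t) ^ p ∂μ) * (A ^ (s / r - 1) * B ^ (s / p - 1)) ∂μ :=
        lintegral_mono hpt
    _ = A * B * (A ^ (s / r - 1) * B ^ (s / p - 1)) := by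
        rw [lintegral_mul_const'' _ hconv.lintegral_prod_right', hAB]
    _ = (A ^ (1 : ℝ) * A ^ (s / r - 1)) * (B ^ (1 : ℝ) * B ^ (s / p - 1)) := by
        rw [ENNReal.rpow_one, ENNReal.rpow_one]; ring
    _ = _ := by
        rw [← ENNReal.rpow_add_of_nonneg _ _ (by norm_num) hsr,
          ← ENNReal.rpow_add_of_nonneg _ _ (by norm_num) hsp, add_sub_cancel, add_sub_cancel]

end Young

/-! ### Growth of the nonlinearity -/

lemma exists_growth {f : ℝ → ℝ} {θ : ℝ} (hf : Continuous f) (hθ : 2 < θ)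
    (hneg : ∀ t, t < 0 → f t = 0)
    (hf1 : Tendsto (fun t => |f t| / t) (𝓝[≠] 0) (𝓝 0))
    (hf2 : Tendsto (fun t => f t / t ^ (θ - 1)) atTop (𝓝 0)) :
    ∃ C : ℝ, 0 ≤ C ∧ (∀ t, |f t| ≤ C * (1 + |t| ^ (θ - 2)) * |t|) ∧
      ∀ t, |prim f t| ≤ C * (|t| ^ (2 : ℝ) + |t| ^ θ) := by
  have hf0 : f 0 = 0 := by
    have h1 : Tendsto f (𝓝[<] 0) (𝓝 (f 0)) := (hf.tendsto 0).mono_left nhdsWithin_le_nhds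
    refine tendsto_nhds_unique h1 (tendsto_const_nhds.congr' ?_)
    filter_upwards [self_mem_nhdsWithin] with t ht using (hneg t ht).symm
  obtain ⟨δ, hδ, hδf⟩ : ∃ δ > 0, ∀ t, 0 < t → t < δ → |f t| ≤ t := by
    have h1 := hf1.eventually_lt_const one_pos
    rw [eventually_nhdsWithin_iff, Metric.eventually_nhds_iff] at h1
    obtain ⟨δ, hδ, h⟩ := h1
    refine ⟨δ, hδ, fun t ht htδ => ?_⟩
    have := h (y := t) (by rwa [Real.dist_eq, sub_zero, abs_of_pos ht]) ht.ne'
    rw [div_lt_one ht] at this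
    exact this.le
  obtain ⟨R, hR1, hR⟩ : ∃ R ≥ 1, ∀ t, R ≤ t → |f t| ≤ t ^ (θ - 1) := by
    have h1 := (hf2.abs.eventually_lt_const (u := 1) (by simp)).and (eventually_ge_atTop 1)
    obtain ⟨R, h⟩ := eventually_atTop.1 h1
    refine ⟨max R 1, le_max_right _ _, fun t ht => ?_⟩
    obtain ⟨h2, h3⟩ := h t ((le_max_left _ _).trans ht)
    have hp : 0 < t ^ (θ - 1) := Real.rpow_pos_of_pos (by linarith) _
    rw [abs_div, abs_of_pos hp, div_lt_one hp] at h2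
    exact h2.le
  obtain ⟨b, hb⟩ := (isCompact_Icc (a := (0 : ℝ)) (b := R)).exists_bound_of_continuousOn
    hf.continuousOn
  have hb0 : 0 ≤ b := (norm_nonneg _).trans (hb 0 ⟨le_rfl, by linarith⟩)
  set C := 1 + b / δ with hC
  have hC1 : 1 ≤ C := le_add_of_nonneg_right (by positivity)
  have key : ∀ t, |f t| ≤ C * (1 + |t| ^ (θ - 2)) * |t| := by
    intro t
    have hq : 0 ≤ |t| ^ (θ - 2) := Real.rpow_nonneg (abs_nonneg t) _
    have hlow : ∀ D : ℝ, D ≤ C * |t| → D ≤ C * (1 + |t| ^ (θ - 2)) * |t| := fun D hD => by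
      nlinarith [mul_nonneg (mul_nonneg (by linarith : 0 ≤ C) hq) (abs_nonneg t)]
    rcases lt_trichotomy t 0 with ht | rfl | ht
    · rw [hneg t ht, abs_zero]; positivity
    · rw [hf0]; simp
    · have hat : |t| = t := abs_of_pos ht
      rcases lt_or_ge t δ with h1 | h1
      · refine hlow _ ((hδf t ht h1).trans ?_)
        rw [hat]; exact le_mul_of_one_le_left ht.le hC1
      rcases le_total t R with h2 | h2
      · refine hlow _ ((hb t ⟨ht.le, h2⟩).trans ?_)
        have : b = b / δ * δ := by field_simp
        rw [hat, this]
        exact mul_le_mul (by linarith) h1 hδ.le (by linarith)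
      · refine (hR t h2).trans ?_
        have e : t ^ (θ - 1) = t ^ (θ - 2) * t := by
          nth_rewrite 3 [← Real.rpow_one t]
          rw [← Real.rpow_add ht]; congr 1; ring
        rw [e, hat]
        rw [hat] at hq
        gcongr
        nlinarith
  refine ⟨C, by linarith, key, fun t => ?_⟩
  have h1 : ‖∫ s in (0 : ℝ)..t, f s‖ ≤ C * (1 + |t| ^ (θ - 2)) * |t| * |t - 0| := by
    refine intervalIntegral.norm_integral_le_of_norm_le_const fun s hs => ?_
    have hst : |s| ≤ |t| := by
      rcases le_total 0 t with h | h
      · rw [uIoc_of_le h] at hs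
        rw [abs_of_pos hs.1, abs_of_nonneg h]; exact hs.2
      · rw [uIoc_of_ge h] at hs
        rw [abs_of_nonpos hs.2, abs_of_nonpos h]; linarith [hs.1]
    refine (key s).trans ?_
    have : |s| ^ (θ - 2) ≤ |t| ^ (θ - 2) := Real.rpow_le_rpow (abs_nonneg _) hst (by linarith)
    gcongr
  refine h1.trans (le_of_eq ?_)
  have e : |t| ^ θ = |t| ^ (θ - 2) * |t| ^ (2 : ℝ) := by
    rw [← Real.rpow_add_of_nonneg (abs_nonneg _) (by linarith) (by norm_num)]; congr 1; ring
  rw [e, Real.rpow_two, sub_zero]; ring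

/-! ### The nonlocal coefficient -/

lemma continuous_prim {f : ℝ → ℝ} (hf : Continuous f) : Continuous (prim f) :=
  intervalIntegral.continuous_primitive (fun _ _ => hf.intervalIntegrable _ _) 0

lemma aestronglyMeasurable_hartree {N : ℕ} {W u : Bdry N → ℝ} {f : ℝ → ℝ} (hf : Continuous f)
    (hW : AEStronglyMeasurable W volume) (hu : AEStronglyMeasurable u volume) :
    AEStronglyMeasurable (hartree W f u) volume :=
  (AEStronglyMeasurable.convolution_integrand (ContinuousLinearMap.mul ℝ ℝ) hW
    ((continuous_prim hf).comp_aestronglyMeasurable hu)).integral_prod_right'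

/-- The `L^s` part of the convolution of an `L^r` and an `L^p` function. -/
lemma memLp_toReal_lconvolution {N : ℕ} {W F : Bdry N → ℝ} {p r s : ℝ} (hs : 0 < s) (hr : 0 < r)
    (hp : 0 < p) (hrs : 1 / s ≤ 1 / r) (hps : 1 / s ≤ 1 / p) (h : 1 / r + 1 / p = 1 + 1 / s)
    (hW : MemLp W (ENNReal.ofReal r) volume) (hF : MemLp F (ENNReal.ofReal p) volume) :
    MemLp (fun y => (∫⁻ t, ‖W t‖ₑ * ‖F (y - t)‖ₑ).toReal) (ENNReal.ofReal s) volume ∧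
      ∀ᵐ y, ∫⁻ t, ‖W t‖ₑ * ‖F (y - t)‖ₑ < ⊤ := by
  have hfin : ∀ {g : Bdry N → ℝ} {p : ℝ}, 0 < p → MemLp g (ENNReal.ofReal p) volume →
      ∫⁻ t, ‖g t‖ₑ ^ p < ⊤ := fun {g p} hp hg => by
    have := hg.eLpNorm_lt_top
    rwa [eLpNorm_lt_top_iff_lintegral_rpow_enorm_lt_top (by simpa using hp) ENNReal.ofReal_ne_top,
      ENNReal.toReal_ofReal hp.le] at this
  have hm : AEMeasurable (fun y => ∫⁻ t, ‖W t‖ₑ * ‖F (y - t)‖ₑ) (volume : Measure (Bdry N)) := by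
    refine AEMeasurable.lintegral_prod_right'
      (f := fun z : Bdry N × Bdry N => ‖W z.2‖ₑ * ‖F (z.1 - z.2)‖ₑ) (ν := volume) ?_
    exact hW.aestronglyMeasurable.enorm.comp_snd.mul
      (hF.aestronglyMeasurable.enorm.comp_quasiMeasurePreserving
        (quasiMeasurePreserving_sub volume volume))
  have hY : ∫⁻ y, (∫⁻ t, ‖W t‖ₑ * ‖F (y - t)‖ₑ) ^ s < ⊤ := by
    refine (lintegral_convolution_rpow_le (μ := (volume : Measure (Bdry N)))
      hW.aestronglyMeasurable.enorm hF.aestronglyMeasurable.enorm hs hr hp hrs hps h).trans_lt ?_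
    exact ENNReal.mul_lt_top (ENNReal.rpow_lt_top_of_nonneg (by positivity) (hfin hr hW).ne)
      (ENNReal.rpow_lt_top_of_nonneg (by positivity) (hfin hp hF).ne)
  constructor
  · refine ⟨hm.ennreal_toReal.aestronglyMeasurable, ?_⟩
    rw [eLpNorm_lt_top_iff_lintegral_rpow_enorm_lt_top (by simpa using hs) ENNReal.ofReal_ne_top,
      ENNReal.toReal_ofReal hs.le]
    refine (lintegral_mono fun y => ENNReal.rpow_le_rpow ?_ hs.le).trans_lt hY
    rw [Real.enorm_of_nonneg ENNReal.toReal_nonneg]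
    exact ENNReal.ofReal_toReal_le
  · filter_upwards [ae_lt_top' (hm.pow_const s) hY.ne] with y hy
    by_contra! htop
    rw [top_le_iff.1 htop, ENNReal.top_rpow_of_pos hs] at hy
    exact hy.ne rfl

lemma enorm_hartree_le {N : ℕ} {W W₁ W₂ u : Bdry N → ℝ} {f : ℝ → ℝ} (hf : Continuous f)
    (hW : W =ᵐ[volume] W₁ + W₂) (hW₁ : AEStronglyMeasurable W₁ volume)
    (hu : AEStronglyMeasurable u volume) (y : Bdry N) :
    ‖hartree W f u y‖ₑ ≤ (∫⁻ t, ‖W₁ t‖ₑ * ‖prim f (u (y - t))‖ₑ) +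
      eLpNorm W₂ ⊤ volume * eLpNorm (fun y => prim f (u y)) 1 volume := by
  have hF : AEStronglyMeasurable (fun y => prim f (u y)) volume :=
    (continuous_prim hf).comp_aestronglyMeasurable hu
  have hFy : AEMeasurable (fun t => ‖prim f (u (y - t))‖ₑ) (volume : Measure (Bdry N)) :=
    hF.enorm.comp_quasiMeasurePreserving (quasiMeasurePreserving_sub_left volume y)
  calc ‖hartree W f u y‖ₑ ≤ ∫⁻ t, ‖W t * prim f (u (y - t))‖ₑ :=
        enorm_integral_le_lintegral_enorm _
    _ ≤ ∫⁻ t, (‖W₁ t‖ₑ * ‖prim f (u (y - t))‖ₑ +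
          eLpNorm W₂ ⊤ volume * ‖prim f (u (y - t))‖ₑ) := by
        refine lintegral_mono_ae ?_
        filter_upwards [hW, enorm_ae_le_eLpNormEssSup W₂ volume] with t ht ht2
        rw [ht, enorm_mul, Pi.add_apply, ← add_mul, eLpNorm_exponent_top]
        gcongr
        exact (enorm_add_le _ _).trans (by gcongr)
    _ = _ := by
        have hWF : AEMeasurable (fun t => ‖W₁ t‖ₑ * ‖prim f (u (y - t))‖ₑ)
          (volume : Measure (Bdry N)) := hW₁.enorm.mul hFy
        rw [lintegral_add_left' hWF, lintegral_const_mul'' _ hFy,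
          lintegral_sub_left_eq_self (fun t => ‖prim f (u t)‖ₑ) y, eLpNorm_one_eq_lintegral_enorm]

/-- The boundary nonlinearity is a subcritical multiple of `u`. -/
lemma exists_hartree_coefficient {N : ℕ} (hN : 2 ≤ N) {f : ℝ → ℝ} {θ r s : ℝ}
    {W W₁ W₂ u : Bdry N → ℝ} (hf : Continuous f) (hneg : ∀ t, t < 0 → f t = 0)
    (hs : s = 2 * N / (N - 1)) (hθ : 2 < θ) (hθs : θ < s)
    (hf1 : Tendsto (fun t => |f t| / t) (𝓝[≠] 0) (𝓝 0))
    (hf2 : Tendsto (fun t => f t / t ^ (θ - 1)) atTop (𝓝 0))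
    (hr : (N : ℝ) / ((N : ℝ) * (2 - θ) + θ) < r)
    (hW : W =ᵐ[volume] W₁ + W₂) (hW₁ : MemLp W₁ (ENNReal.ofReal r) volume)
    (hW₂ : MemLp W₂ ⊤ volume) (hu : MemLp u 2 volume) (hus : MemLp u (ENNReal.ofReal s) volume) :
    ∃ (c q : ℝ) (g : Bdry N → ℝ), 0 ≤ c ∧ (N : ℝ) < q ∧ MemLp g (ENNReal.ofReal q) volume ∧
      ∀ᵐ y, |hartree W f u y * f (u y)| ≤ (c + |g y|) * |u y| := by
  have hN' : (2 : ℝ) ≤ N := by exact_mod_cast hN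
  have hs0 : 0 < s := by linarith
  have hu2 : MemLp u (ENNReal.ofReal 2) volume := by simpa using hu
  have hum := hu.aestronglyMeasurable
  obtain ⟨C, hC, hgf, hgF⟩ := exists_growth hf hθ hneg hf1 hf2
  -- exponents
  set τ := 1 / s with hτ
  have hτ0 : 0 < τ := by positivity
  have hτN : 1 / (N : ℝ) = 1 - 2 * τ := by
    rw [hτ, hs]
    have : (N : ℝ) - 1 ≠ 0 := by linarith
    field_simp; ring
  have hθτ : θ * τ < 1 := by rw [hτ, mul_one_div, div_lt_one hs0]; exact hθs
  have hN1 : 0 < 1 / (N : ℝ) := by positivity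
  have hden : (N : ℝ) * (2 - θ) + θ = N * (2 - 2 * (θ * τ)) := by
    have : (N : ℝ) * (1 / N) = 1 := by field_simp
    linear_combination (-θ) * this + θ * N * hτN
  have hden0 : 0 < 2 - 2 * (θ * τ) := by linarith
  have hr0' : 1 / (2 - 2 * (θ * τ)) < r := by
    rw [hden] at hr
    refine lt_of_le_of_lt (le_of_eq ?_) hr
    field_simp
  have hr0 : 0 < r := lt_trans (by positivity) hr0'
  have hr1 : 1 / r < 2 - 2 * (θ * τ) := (one_div_lt hden0 hr0).1 hr0'
  have hr2 : 1 / r ≤ 1 := by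
    have h1 : 2 * τ < θ * τ := by gcongr
    have h2 : 1 / (N : ℝ) ≤ 1 / 2 := one_div_le_one_div_of_le two_pos hN'
    linarith
  obtain ⟨α, hα0, hαr, hα1, hα2⟩ : ∃ α : ℝ, 0 < α ∧ α ≤ 1 / r ∧ 1 / r + θ * τ - 1 ≤ α ∧
      α < 1 - θ * τ := by
    have hr3 : 0 < 1 / r := by positivity
    refine ⟨max (1 / r + θ * τ - 1) (min (1 / r) ((1 - θ * τ) / 2)),
      lt_max_of_lt_right (lt_min hr3 (by linarith)), max_le (by linarith) (min_le_left _ _),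
      le_max_left _ _, max_lt (by linarith) ((min_le_right _ _).trans_lt (by linarith))⟩
  set σ := 1 / α with hσ
  have hσ0 : 0 < σ := by positivity
  have hσα : 1 / σ = α := by rw [hσ, one_div_one_div]
  set p := 1 / (1 + α - 1 / r) with hp
  have hp' : 0 < 1 + α - 1 / r := by nlinarith
  have hp0 : 0 < p := by positivity
  have hpα : 1 / p = 1 + α - 1 / r := by rw [hp, one_div_one_div]
  have hp1 : 1 ≤ p := by rw [hp, le_div_iff₀ hp']; linarith
  have hpθ : θ * p ≤ s := by
    have h1 : θ * τ * p ≤ 1 := by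
      rw [hp, mul_one_div, div_le_one hp']; linarith
    have h2 : θ * p = θ * τ * p * s := by rw [hτ]; field_simp
    rw [h2]; exact mul_le_of_le_one_left hs0.le h1
  set q := 1 / (α + (θ - 2) * τ) with hq
  have hqd : 0 < α + (θ - 2) * τ := add_pos hα0 (mul_pos (by linarith) hτ0)
  have hq0 : 0 < q := by positivity
  have hqα : 1 / q = α + (θ - 2) * τ := by rw [hq, one_div_one_div]
  have hqN : (N : ℝ) < q := by
    rw [hq, lt_one_div (by linarith) hqd, hτN]; linarith
  -- integrability of `F(u)`
  have hFm : AEStronglyMeasurable (fun y => prim f (u y)) volume :=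
    (continuous_prim hf).comp_aestronglyMeasurable hum
  have hFp : ∀ p : ℝ, 1 ≤ p → θ * p ≤ s →
      MemLp (fun y => prim f (u y)) (ENNReal.ofReal p) volume := fun p hp1 hpθ => by
    have hp0 : 0 < p := by linarith
    have h1 : MemLp (fun y => |u y| ^ (2 : ℝ)) (ENNReal.ofReal p) volume :=
      memLp_rpow two_pos hp0 (memLp_of_between two_pos (by linarith) (by nlinarith) hu2 hus)
    have h2 : MemLp (fun y => |u y| ^ θ) (ENNReal.ofReal p) volume :=
      memLp_rpow (by linarith) hp0 (memLp_of_between two_pos (by nlinarith) hpθ hu2 hus)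
    refine (h1.add h2).of_le_mul (c := C) hFm (Eventually.of_forall fun y => ?_)
    rw [Pi.add_apply, Real.norm_of_nonneg (add_nonneg (Real.rpow_nonneg (abs_nonneg _) _)
      (Real.rpow_nonneg (abs_nonneg _) _))]
    exact hgF _
  obtain ⟨hH, hHfin⟩ := memLp_toReal_lconvolution (W := W₁) (F := fun y => prim f (u y))
    hσ0 hr0 hp0 (by rw [hσα]; exact hαr) (by rw [hσα, hpα]; linarith)
    (by rw [hσα, hpα]; ring) hW₁ (hFp p hp1 hpθ)
  set H : Bdry N → ℝ := fun y => (∫⁻ t, ‖W₁ t‖ₑ * ‖prim f (u (y - t))‖ₑ).toReal with hHdef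
  have hH0 : ∀ y, 0 ≤ H y := fun y => ENNReal.toReal_nonneg
  have hcfin : eLpNorm W₂ ⊤ volume * eLpNorm (fun y => prim f (u y)) 1 volume ≠ ⊤ := by
    have := hFp 1 le_rfl (by linarith)
    rw [ENNReal.ofReal_one] at this
    exact ENNReal.mul_ne_top hW₂.eLpNorm_ne_top this.eLpNorm_ne_top
  set c₂ := (eLpNorm W₂ ⊤ volume * eLpNorm (fun y => prim f (u y)) 1 volume).toReal with hc₂
  have hc0 : 0 ≤ c₂ := ENNReal.toReal_nonneg
  have hh : ∀ᵐ y, |hartree W f u y| ≤ H y + c₂ := by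
    filter_upwards [hHfin] with y hy
    have h1 := ENNReal.toReal_mono (ENNReal.add_ne_top.2 ⟨hy.ne, hcfin⟩)
      (enorm_hartree_le hf hW hW₁.aestronglyMeasurable hum y)
    rw [ENNReal.toReal_add hy.ne hcfin, toReal_enorm] at h1
    exact h1
  -- the three parts of the coefficient
  have hqσ : q ≤ σ := by
    rw [hq, hσ]
    exact one_div_le_one_div_of_le hα0 (le_add_of_nonneg_right
      (mul_nonneg (by linarith) hτ0.le))
  have hqs : q * (θ - 2) ≤ s := by
    have h1 : (θ - 2) * τ * q ≤ 1 := by rw [hq, mul_one_div, div_le_one hqd]; linarith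
    have h2 : q * (θ - 2) = (θ - 2) * τ * q * s := by rw [hτ]; field_simp
    rw [h2]; exact mul_le_of_le_one_left hs0.le h1
  have hg1 : MemLp (fun y => |H y| ^ (σ / q)) (ENNReal.ofReal q) volume :=
    memLp_rpow (by positivity) hq0 (by rwa [div_mul_cancel₀ _ hq0.ne'])
  have hg2 : MemLp (fun y => |u y| ^ (s / q)) (ENNReal.ofReal q) volume :=
    memLp_rpow (by positivity) hq0 (by rwa [div_mul_cancel₀ _ hq0.ne'])
  have hU : MemLp (fun y => |u y| ^ (θ - 2)) (ENNReal.ofReal (s / (θ - 2))) volume :=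
    memLp_rpow (by linarith) (div_pos hs0 (by linarith))
      (by rwa [mul_div_cancel₀ _ (by linarith : θ - 2 ≠ 0)])
  have hg3 : MemLp (fun y => H y * |u y| ^ (θ - 2)) (ENNReal.ofReal q) volume :=
    memLp_mul hσ0 (div_pos hs0 (by linarith)) hq0 (by rw [hσα, hqα, hτ, one_div_div]; ring) hH hU
  refine ⟨C * (1 + 2 * c₂), q, fun y => C * (|H y| ^ (σ / q) + H y * |u y| ^ (θ - 2) +
    c₂ * |u y| ^ (s / q)), by positivity, hqN,
    ((hg1.add hg3).add (hg2.const_mul c₂)).const_mul C, ?_⟩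
  filter_upwards [hh] with y hy
  have a1 : 0 ≤ |H y| ^ (σ / q) := Real.rpow_nonneg (abs_nonneg _) _
  have a2 : 0 ≤ |u y| ^ (θ - 2) := Real.rpow_nonneg (abs_nonneg _) _
  have a3 : 0 ≤ |u y| ^ (s / q) := Real.rpow_nonneg (abs_nonneg _) _
  have b1 : H y ≤ 1 + |H y| ^ (σ / q) := by
    have := rpow_le_add_rpow (abs_nonneg (H y)) le_rfl zero_le_one ((one_le_div hq0).2 hqσ)
    rw [Real.rpow_one, Real.rpow_zero, abs_of_nonneg (hH0 y)] at this
    rwa [abs_of_nonneg (hH0 y)]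
  have b2 : |u y| ^ (θ - 2) ≤ 1 + |u y| ^ (s / q) := by
    have := rpow_le_add_rpow (abs_nonneg (u y)) le_rfl (show 0 ≤ θ - 2 by linarith)
      (show θ - 2 ≤ s / q by rw [le_div_iff₀ hq0]; linarith)
    rwa [Real.rpow_zero] at this
  rw [abs_of_nonneg (mul_nonneg hC (add_nonneg (add_nonneg a1 (mul_nonneg (hH0 y) a2))
    (mul_nonneg hc0 a3))), abs_mul]
  calc |hartree W f u y| * |f (u y)| ≤ (H y + c₂) * (C * (1 + |u y| ^ (θ - 2)) * |u y|) :=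
        mul_le_mul hy (hgf _) (abs_nonneg _) (add_nonneg (hH0 y) hc0)
    _ = C * (H y + H y * |u y| ^ (θ - 2) + c₂ + c₂ * |u y| ^ (θ - 2)) * |u y| := by ring
    _ ≤ C * ((1 + |H y| ^ (σ / q)) + H y * |u y| ^ (θ - 2) + c₂ +
          c₂ * (1 + |u y| ^ (s / q))) * |u y| := by gcongr
    _ = _ := by ring

/-- A subcritical multiple of `u` is integrable against `L² ∩ L^s`. -/
lemma integrable_coefficient_mul {N : ℕ} (hN : 2 ≤ N) {s c q : ℝ} {u w B g : Bdry N → ℝ}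
    (hs : s = 2 * N / (N - 1)) (hq : (N : ℝ) < q) (hu : MemLp u 2 volume)
    (hus : MemLp u (ENNReal.ofReal s) volume) (hw : MemLp w 2 volume)
    (hws : MemLp w (ENNReal.ofReal s) volume) (hB : AEStronglyMeasurable B volume)
    (hg : MemLp g (ENNReal.ofReal q) volume) (hBg : ∀ᵐ y, |B y| ≤ (c + |g y|) * |u y|) :
    Integrable (fun y => B y * w y) volume := by
  have hN' : (2 : ℝ) ≤ N := by exact_mod_cast hN
  have hq1 : 0 < q - 1 := by linarith
  set κ := q / (q - 1) with hκ
  have hκ1 : 1 ≤ κ := by rw [hκ, one_le_div hq1]; linarith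
  have hκs : 2 * κ ≤ s := by
    rw [hκ, hs, mul_div_assoc]
    refine mul_le_mul_of_nonneg_left ?_ two_pos.le
    rw [div_le_div_iff₀ hq1 (by linarith)]; nlinarith
  have hb : ∀ {u : Bdry N → ℝ}, MemLp u 2 volume → MemLp u (ENNReal.ofReal s) volume →
      MemLp u (ENNReal.ofReal (2 * κ)) volume := fun {u} hu hus =>
    memLp_of_between two_pos (by linarith) hκs (by simpa using hu) hus
  have h1 : MemLp (fun y => u y * w y) (ENNReal.ofReal κ) volume :=
    memLp_mul (p := 2 * κ) (q := 2 * κ) (by positivity) (by positivity) (by positivity)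
      (by field_simp; norm_num) (hb hu hus) (hb hw hws)
  have h2 : MemLp (fun y => g y * (u y * w y)) (ENNReal.ofReal 1) volume :=
    memLp_mul (by linarith) (by positivity) one_pos (by
      have : q ≠ 0 := by linarith
      rw [hκ]; field_simp; ring) hg h1
  rw [ENNReal.ofReal_one, memLp_one_iff_integrable] at h2
  have h3 : Integrable (fun y => u y * w y) volume := hu.integrable_mul hw
  refine ((h3.norm.const_mul c).add h2.norm).mono' (hB.mul hw.aestronglyMeasurable) ?_
  filter_upwards [hBg] with y hy
  simp only [Pi.add_apply, norm_mul, Real.norm_eq_abs]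
  calc |B y| * |w y| ≤ (c + |g y|) * |u y| * |w y| :=
        mul_le_mul_of_nonneg_right hy (abs_nonneg _)
    _ = _ := by ring

/-! ### Existence of traces -/

/-- A bump function supported in `{x < 0}`, close to the origin. -/
noncomputable def shiftedBump (N n : ℕ) : ContDiffBump ((-2 / ((n : ℝ) + 1), 0) : Amb N) where
  rIn := 1 / (2 * ((n : ℝ) + 1))
  rOut := 1 / ((n : ℝ) + 1)
  rIn_pos := by positivity
  rIn_lt_rOut := one_div_lt_one_div_of_lt (by positivity) (by linarith [n.cast_nonneg (α := ℝ)])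

/-- A mollifier supported in `{x < 0}`. -/
noncomputable def mollifier (N n : ℕ) : Amb N → ℝ := (shiftedBump N n).normed volume

lemma contDiff_mollifier (N n : ℕ) : ContDiff ℝ ∞ (mollifier N n) :=
  (shiftedBump N n).contDiff_normed (n := ⊤)

lemma hasCompactSupport_mollifier (N n : ℕ) : HasCompactSupport (mollifier N n) :=
  (shiftedBump N n).hasCompactSupport_normed

lemma fst_neg_of_mem_tsupport_mollifier {N n : ℕ} {z : Amb N} (hz : z ∈ tsupport (mollifier N n)) :
    z.1 < 0 := by
  rw [mollifier, ContDiffBump.tsupport_normed_eq, mem_closedBall_iff_norm] at hz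
  have h1 : |z.1 - -2 / ((n : ℝ) + 1)| ≤ 1 / ((n : ℝ) + 1) := (norm_fst_le _).trans hz
  have h2 : 0 < 1 / ((n : ℝ) + 1) := by positivity
  have h3 : -2 / ((n : ℝ) + 1) = -2 * (1 / ((n : ℝ) + 1)) := by ring
  rw [h3] at h1
  linarith [(abs_le.1 h1).2]

lemma support_mollifier_subset (N n : ℕ) :
    Function.support (mollifier N n) ⊆ Metric.ball 0 (3 / ((n : ℝ) + 1)) := by
  rw [mollifier, ContDiffBump.support_normed_eq]
  refine Metric.ball_subset_ball' ?_
  have h0 : (0 : ℝ) < (n : ℝ) + 1 := by positivity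
  rw [dist_zero_right, Prod.norm_def]
  simp only [norm_zero, norm_div, norm_neg, Real.norm_ofNat, Real.norm_of_nonneg h0.le, shiftedBump]
  rw [max_eq_left (by positivity), ← add_div]
  norm_num

/-- Regularisation by the mollifier. -/
noncomputable def mollify {N : ℕ} (n : ℕ) (f : Amb N → ℝ) : Amb N → ℝ :=
  f ⋆[ContinuousLinearMap.mul ℝ ℝ, volume] mollifier N n

lemma mollify_apply {N : ℕ} (n : ℕ) (f : Amb N → ℝ) (z : Amb N) :
    mollify n f z = ∫ t, f t * mollifier N n (z - t) := rfl

lemma mollify_eq_lsmul {N : ℕ} (n : ℕ) (f : Amb N → ℝ) :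
    mollify n f = mollifier N n ⋆[ContinuousLinearMap.lsmul ℝ ℝ, volume] f := by
  ext z
  rw [convolution_lsmul_swap, mollify_apply]
  simp only [smul_eq_mul, mul_comm]

lemma contDiff_mollify {N n : ℕ} {f : Amb N → ℝ} (hf : LocallyIntegrable f volume) :
    ContDiff ℝ ∞ (mollify n f) :=
  (hasCompactSupport_mollifier N n).contDiff_convolution_right _ hf (contDiff_mollifier N n)

lemma mollify_sub {N n : ℕ} {f g : Amb N → ℝ} (hf : LocallyIntegrable f volume)
    (hg : LocallyIntegrable g volume) (z : Amb N) :
    mollify n (f - g) z = mollify n f z - mollify n g z := by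
  have h : ∀ {f : Amb N → ℝ}, LocallyIntegrable f volume →
      Integrable (fun t => f t * mollifier N n (z - t)) volume := fun hf =>
    ((hasCompactSupport_mollifier N n).convolutionExists_right (ContinuousLinearMap.mul ℝ ℝ) hf
      (contDiff_mollifier N n).continuous z).integrable
  rw [mollify_apply, mollify_apply, mollify_apply, ← integral_sub (h hf) (h hg)]
  simp [sub_mul]

lemma lintegral_mollifier (N n : ℕ) : ∫⁻ z, ‖mollifier N n z‖ₑ ^ (1 : ℝ) = 1 := by
  have h0 : ∀ z, 0 ≤ mollifier N n z := fun z => (shiftedBump N n).nonneg_normed z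
  have := ofReal_integral_eq_lintegral_ofReal ((shiftedBump N n).integrable_normed (μ := volume))
    (Eventually.of_forall h0)
  rw [ContDiffBump.integral_normed, ENNReal.ofReal_one] at this
  rw [this]
  refine lintegral_congr fun z => ?_
  rw [ENNReal.rpow_one, Real.enorm_of_nonneg (h0 z)]
  rfl

lemma eLpNorm_mollify_le {N n : ℕ} {f : Amb N → ℝ} (hf : AEStronglyMeasurable f volume) :
    eLpNorm (mollify n f) 2 volume ≤ eLpNorm f 2 volume := by
  have hY := lintegral_convolution_rpow_le (μ := (volume : Measure (Amb N)))
    (contDiff_mollifier N n).continuous.enorm.measurable.aemeasurable hf.enorm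
    (s := 2) (r := 1) (p := 2) two_pos one_pos two_pos (by norm_num) le_rfl (by norm_num)
  rw [lintegral_mollifier, ENNReal.one_rpow, one_mul, div_self two_ne_zero, ENNReal.rpow_one] at hY
  rw [eLpNorm_eq_lintegral_rpow_enorm_toReal two_ne_zero ENNReal.ofNat_ne_top,
    eLpNorm_eq_lintegral_rpow_enorm_toReal two_ne_zero ENNReal.ofNat_ne_top, ENNReal.toReal_ofNat]
  gcongr ?_ ^ _
  refine le_trans (lintegral_mono fun z => ENNReal.rpow_le_rpow ?_ two_pos.le) hY
  rw [mollify_eq_lsmul]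
  refine (enorm_integral_le_lintegral_enorm _).trans (le_of_eq ?_)
  simp only [ContinuousLinearMap.lsmul_apply, smul_eq_mul, enorm_mul]

lemma tendsto_mollify_of_continuous {N : ℕ} {k : Amb N → ℝ} (hk : Continuous k)
    (hkc : HasCompactSupport k) :
    Tendsto (fun n => eLpNorm (fun z => mollify n k z - k z) 2 volume) atTop (𝓝 0) := by
  obtain ⟨R, hR⟩ := hkc.isCompact.isBounded.subset_closedBall (0 : Amb N)
  set A := Metric.closedBall (0 : Amb N) (R + 3) with hA
  have hAfin : volume A ≠ ⊤ := measure_closedBall_lt_top.ne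
  have huc : UniformContinuous k := hkc.uniformContinuous_of_continuous hk
  have hrad : Tendsto (fun n : ℕ => 3 / ((n : ℝ) + 1)) atTop (𝓝 0) := by
    have := tendsto_one_div_add_atTop_nhds_zero_nat (𝕜 := ℝ) |>.const_mul 3
    simpa [div_eq_mul_inv] using this
  have hbound : ∀ ε : ℝ, 0 < ε → ∀ᶠ n in atTop,
      eLpNorm (fun z => mollify n k z - k z) 2 volume ≤
        ENNReal.ofReal ε * volume A ^ (1 / 2 : ℝ) := by
    intro ε hε
    obtain ⟨δ, hδ, hδk⟩ := Metric.uniformContinuous_iff.1 huc ε hε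
    filter_upwards [hrad.eventually_lt_const hδ] with n hn
    have h1 : ∀ z, dist (mollify n k z) (k z) ≤ ε := fun z => by
      rw [mollify_eq_lsmul]
      refine dist_convolution_le hε.le (support_mollifier_subset N n)
        (fun z => (shiftedBump N n).nonneg_normed z) (shiftedBump N n).integral_normed
        hk.aestronglyMeasurable fun x hx => (hδk ?_).le
      exact (Metric.mem_ball.1 hx).trans hn
    have h2 : ∀ z ∉ A, mollify n k z - k z = 0 := fun z hz => by
      have hz' : R + 3 < ‖z‖ := by simpa [hA] using hz
      have hk0 : ∀ w : Amb N, R < ‖w‖ → k w = 0 := fun w hw =>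
        image_eq_zero_of_notMem_tsupport fun h => by
          have := mem_closedBall_zero_iff.1 (hR h); linarith
      rw [hk0 z (by linarith), sub_zero, mollify_apply]
      refine integral_eq_zero_of_ae (Eventually.of_forall fun t => ?_)
      by_cases ht : R < ‖t‖
      · simp [hk0 t ht]
      · have : mollifier N n (z - t) = 0 := by
          by_contra hne
          have h3 := mem_ball_zero_iff.1 (support_mollifier_subset N n hne)
          have h4 : 3 / ((n : ℝ) + 1) ≤ 3 := div_le_self (by norm_num)
            (by linarith [n.cast_nonneg (α := ℝ)])
          linarith [norm_sub_norm_le z t, not_lt.1 ht]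
        simp [this]
    calc eLpNorm (fun z => mollify n k z - k z) 2 volume
        ≤ eLpNorm (A.indicator fun _ => ε) 2 volume := by
          refine eLpNorm_mono fun z => ?_
          by_cases hz : z ∈ A
          · rw [indicator_of_mem hz, ← dist_eq_norm, Real.norm_of_nonneg hε.le]
            exact h1 z
          · rw [h2 z hz, indicator_of_notMem hz]
      _ = ENNReal.ofReal ε * volume A ^ (1 / 2 : ℝ) := by
          rw [eLpNorm_indicator_const measurableSet_closedBall two_ne_zero ENNReal.ofNat_ne_top,
            Real.enorm_of_nonneg hε.le, ENNReal.toReal_ofNat]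
  rw [ENNReal.tendsto_nhds_zero]
  intro η hη
  have hlim : Tendsto (fun ε : ℝ => ENNReal.ofReal ε * volume A ^ (1 / 2 : ℝ)) (𝓝[>] 0) (𝓝 0) := by
    have h1 : Tendsto (fun ε : ℝ => ENNReal.ofReal ε) (𝓝[>] 0) (𝓝 0) := by
      have := (ENNReal.continuous_ofReal.tendsto 0).mono_left (nhdsWithin_le_nhds (s := Ioi 0))
      simpa using this
    simpa using ENNReal.Tendsto.mul_const h1
      (Or.inr (ENNReal.rpow_ne_top_of_nonneg (by norm_num) hAfin))
  obtain ⟨ε, h1, h2⟩ := ((hlim.eventually_lt_const hη).and self_mem_nhdsWithin).exists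
  exact (hbound ε h2).mono fun n hn => hn.trans h1.le

/-- Mollification converges in `L²`. -/
lemma tendsto_mollify {N : ℕ} {f : Amb N → ℝ} (hf : MemLp f 2 volume) :
    Tendsto (fun n => eLpNorm (fun z => mollify n f z - f z) 2 volume) atTop (𝓝 0) := by
  rw [ENNReal.tendsto_nhds_zero]
  intro ε hε
  have hε3 : ε / 3 ≠ 0 := (ENNReal.div_pos hε.ne' (by norm_num)).ne'
  obtain ⟨k, hkc, hfk, hk, hkL⟩ := hf.exists_hasCompactSupport_eLpNorm_sub_le (by norm_num) hε3
  have hfl : LocallyIntegrable f volume := hf.locallyIntegrable (by norm_num)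
  have hkl : LocallyIntegrable k volume := hk.locallyIntegrable
  filter_upwards [(ENNReal.tendsto_nhds_zero.1 (tendsto_mollify_of_continuous hk hkc)) (ε / 3)
    (pos_iff_ne_zero.2 hε3)] with n hn
  have e : (fun z => mollify n f z - f z) =
      (mollify n (f - k) + fun z => mollify n k z - k z) - (f - k) := by
    ext z
    simp only [Pi.sub_apply, Pi.add_apply, mollify_sub hfl hkl]
    ring
  have m1 : AEStronglyMeasurable (mollify n (f - k)) volume :=
    (contDiff_mollify (hfl.sub hkl)).continuous.aestronglyMeasurable
  have m2 : AEStronglyMeasurable (fun z => mollify n k z - k z) volume :=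
    ((contDiff_mollify hkl).continuous.sub hk).aestronglyMeasurable
  have m3 := (hf.sub hkL).aestronglyMeasurable
  rw [e]
  calc _ ≤ eLpNorm (mollify n (f - k)) 2 volume + eLpNorm (fun z => mollify n k z - k z) 2 volume
          + eLpNorm (f - k) 2 volume :=
        (eLpNorm_sub_le (m1.add m2) m3 (by norm_num)).trans
          (add_le_add (eLpNorm_add_le m1 m2 (by norm_num)) le_rfl)
    _ ≤ ε / 3 + ε / 3 + ε / 3 := by
        gcongr
        exact (eLpNorm_mollify_le m3).trans hfk
    _ = ε := ENNReal.add_thirds ε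

/-- Differentiation commutes with the mollification of a function on the half-space. -/
lemma fderiv_mollify {N n : ℕ} {v : Amb N → ℝ} {G : Amb N → Amb N}
    (hv : LocallyIntegrable ((halfSpace N).indicator v) volume) (hG : IsWeakGrad v G) (e : Amb N)
    {z : Amb N} (hz : z ∈ halfSpace N) :
    fderiv ℝ (mollify n ((halfSpace N).indicator v)) z e =
      mollify n ((halfSpace N).indicator fun w => dot (G w) e) z := by
  have hρ := contDiff_mollifier N n
  have hρc := hasCompactSupport_mollifier N n
  have h1 := (hρc.hasFDerivAt_convolution_right (ContinuousLinearMap.mul ℝ ℝ) hv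
    (hρ.of_le (by simp)) z).fderiv
  rw [mollify, h1, convolution_precompR_apply _ hv (hρc.fderiv ℝ) (hρ.continuous_fderiv (by simp)),
    mollify_apply]
  set φ : Amb N → ℝ := fun w => mollifier N n (z - w) with hφ
  have hφs : ContDiff ℝ ∞ φ := hρ.comp (contDiff_const.sub contDiff_id)
  have hφc : HasCompactSupport φ := hρc.comp_homeomorph (Homeomorph.subLeft z)
  have hφt : tsupport φ ⊆ halfSpace N := fun w hw => by
    have : z - w ∈ tsupport (mollifier N n) :=
      tsupport_comp_subset_preimage (mollifier N n) (Homeomorph.subLeft z).continuous hw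
    have h2 := fst_neg_of_mem_tsupport_mollifier this
    have hz' : 0 < z.1 := hz
    simp only [Prod.fst_sub] at h2
    exact show 0 < w.1 by linarith
  have hder : ∀ w, fderiv ℝ φ w e = -fderiv ℝ (mollifier N n) (z - w) e := fun w => by
    have h3 : HasFDerivAt (fun w : Amb N => z - w) (-ContinuousLinearMap.id ℝ (Amb N)) w :=
      (hasFDerivAt_id w).const_sub z
    have := ((hρ.differentiable (by simp) (z - w)).hasFDerivAt.comp w h3).fderiv
    rw [show φ = mollifier N n ∘ fun w => z - w from rfl, this]
    simp
  have h4 := hG.2 φ hφs hφc hφt e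
  rw [halfMeasure, ← integral_indicator (measurableSet_halfSpace N),
    ← integral_indicator (measurableSet_halfSpace N)] at h4
  have e1 : ∀ t, (halfSpace N).indicator (fun w => dot (G w) e) t * mollifier N n (z - t) =
      (halfSpace N).indicator (fun w => dot (G w) e * φ w) t := fun t => by
    by_cases ht : t ∈ halfSpace N <;> simp [ht, hφ]
  have e2 : ∀ t, (halfSpace N).indicator v t * fderiv ℝ (mollifier N n) (z - t) e =
      -(halfSpace N).indicator (fun w => v w * fderiv ℝ φ w e) t := fun t => by
    by_cases ht : t ∈ halfSpace N <;> simp [ht, hder]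
  simp only [convolution_def, ContinuousLinearMap.mul_apply', e1, e2]
  rw [integral_neg, h4, neg_neg]

/-- Smooth cutoffs of growing balls. -/
lemma exists_cutoffs (N : ℕ) : ∃ (χ : ℕ → Amb N → ℝ) (K : ℝ),
    (∀ n, ContDiff ℝ ∞ (χ n) ∧ HasCompactSupport (χ n)) ∧ (∀ n z, |χ n z| ≤ 1) ∧
    (∀ z, Tendsto (fun n => χ n z) atTop (𝓝 1)) ∧
    ∀ n z e, |fderiv ℝ (χ n) z e| ≤ K * ‖e‖ / ((n : ℝ) + 1) := by
  let β : ContDiffBump (0 : Amb N) := ⟨1, 2, one_pos, one_lt_two⟩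
  have hβ : ContDiff ℝ ∞ β := β.contDiff (n := ⊤)
  obtain ⟨K, hK⟩ := (hβ.continuous_fderiv (by simp)).bounded_above_of_compact_support
    (β.hasCompactSupport.fderiv (𝕜 := ℝ))
  have hpos : ∀ n : ℕ, (0 : ℝ) < (n : ℝ) + 1 := fun n => by positivity
  refine ⟨fun n z => β (((n : ℝ) + 1)⁻¹ • z), K, fun n => ⟨hβ.comp (by fun_prop), ?_⟩,
    fun n z => ?_, fun z => ?_, fun n z e => ?_⟩
  · exact β.hasCompactSupport.comp_smul (inv_ne_zero (hpos n).ne')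
  · rw [abs_of_nonneg β.nonneg]; exact β.le_one
  · refine tendsto_const_nhds.congr' ?_
    obtain ⟨n₀, hn₀⟩ := exists_nat_ge ‖z‖
    filter_upwards [eventually_ge_atTop n₀] with n hn
    refine (β.one_of_mem_closedBall ?_).symm
    rw [mem_closedBall_zero_iff, norm_smul, norm_inv, Real.norm_of_nonneg (hpos n).le,
      inv_mul_le_iff₀ (hpos n)]
    have : (n₀ : ℝ) ≤ n := by exact_mod_cast hn
    change ‖z‖ ≤ ((n : ℝ) + 1) * 1
    linarith
  · have h3 : HasFDerivAt (fun z : Amb N => ((n : ℝ) + 1)⁻¹ • z)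
        (((n : ℝ) + 1)⁻¹ • ContinuousLinearMap.id ℝ (Amb N)) z :=
      (ContinuousLinearMap.hasFDerivAt (((n : ℝ) + 1)⁻¹ • ContinuousLinearMap.id ℝ (Amb N)))
    have := ((hβ.differentiable (by simp) _).hasFDerivAt.comp z h3).fderiv
    change |fderiv ℝ (β ∘ fun z => ((n : ℝ) + 1)⁻¹ • z) z e| ≤ _
    rw [this]
    have h4 := (fderiv ℝ β (((n : ℝ) + 1)⁻¹ • z)).le_of_opNorm_le (hK _) (((n : ℝ) + 1)⁻¹ • e)
    rw [norm_smul, norm_inv, Real.norm_of_nonneg (hpos n).le] at h4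
    simp only [ContinuousLinearMap.comp_apply, _root_.smul_apply, ContinuousLinearMap.id_apply]
    refine h4.trans (le_of_eq ?_)
    field_simp

/-- `C_c^∞(ℝ^{N+1})` is dense in `H¹(ℝ^{N+1}_+)`. -/
lemma MemH1.exists_smooth_approx {N : ℕ} {v : Amb N → ℝ} (hv : MemH1 v) :
    ∃ φ : ℕ → Amb N → ℝ, (∀ n, ContDiff ℝ ∞ (φ n) ∧ HasCompactSupport (φ n)) ∧
      Tendsto (fun n => eLpNorm (fun z => φ n z - v z) 2 (halfMeasure N)) atTop (𝓝 0) ∧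
      ∀ e : Amb N, Tendsto (fun n => eLpNorm (fun z => fderiv ℝ (φ n) z e - dot (weakGrad v z) e) 2
        (halfMeasure N)) atTop (𝓝 0) := by
  obtain ⟨χ, K, hχ, hχ1, hχlim, hχd⟩ := exists_cutoffs N
  have hG := hv.isWeakGrad
  have hSm := measurableSet_halfSpace N
  have hext : ∀ {f : Amb N → ℝ}, MemLp f 2 (halfMeasure N) →
      MemLp ((halfSpace N).indicator f) 2 volume := fun hf =>
    (memLp_indicator_iff_restrict hSm).2 hf
  have hvx := hext hv.1
  have hvl : LocallyIntegrable ((halfSpace N).indicator v) volume :=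
    hvx.locallyIntegrable (by norm_num)
  set V : ℕ → Amb N → ℝ := fun n => mollify n ((halfSpace N).indicator v) with hV
  have hVs : ∀ n, ContDiff ℝ ∞ (V n) := fun n => contDiff_mollify hvl
  have hle : ∀ f : Amb N → ℝ, eLpNorm f 2 (halfMeasure N) ≤ eLpNorm f 2 volume := fun f =>
    eLpNorm_mono_measure _ Measure.restrict_le_self
  -- mollified and truncated functions converge
  have hconv : ∀ {f : Amb N → ℝ}, MemLp f 2 (halfMeasure N) →
      Tendsto (fun n => eLpNorm (fun z => χ n z * mollify n ((halfSpace N).indicator f) z - f z) 2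
        (halfMeasure N)) atTop (𝓝 0) := fun {f} hf => by
    have h1 : Tendsto (fun n => eLpNorm (fun z => (χ n z - 1) * f z) 2 (halfMeasure N)) atTop
        (𝓝 0) :=
      tendsto_eLpNorm_mul_of_dominated (C := 2)
        (fun n => ((hχ n).1.continuous.sub continuous_const).aestronglyMeasurable)
        (fun n z => (abs_sub _ _).trans (by rw [abs_one]; linarith [hχ1 n z])) hf
        (Eventually.of_forall fun z => by simpa using (hχlim z).sub_const 1)
    refine tendsto_of_tendsto_of_tendsto_of_le_of_le tendsto_const_nhds
      (by simpa using (tendsto_mollify (hext hf)).add h1) (fun _ => zero_le) fun n => ?_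
    have hM : Continuous (mollify n ((halfSpace N).indicator f)) :=
      (contDiff_mollify ((hext hf).locallyIntegrable (by norm_num))).continuous
    have m1 : AEStronglyMeasurable (fun z => χ n z * (mollify n ((halfSpace N).indicator f) z -
        (halfSpace N).indicator f z)) (halfMeasure N) :=
      (hχ n).1.continuous.aestronglyMeasurable.mul
        (hM.aestronglyMeasurable.sub (hext hf).aestronglyMeasurable.restrict)
    have m2 : AEStronglyMeasurable (fun z => (χ n z - 1) * f z) (halfMeasure N) :=
      ((hχ n).1.continuous.sub continuous_const).aestronglyMeasurable.mul hf.aestronglyMeasurable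
    refine le_trans (le_of_eq (eLpNorm_congr_ae ?_))
      ((eLpNorm_add_le m1 m2 (by norm_num)).trans (add_le_add ((eLpNorm_mono fun z => ?_).trans
        (hle _)) le_rfl))
    · filter_upwards [ae_restrict_mem hSm] with z hz
      rw [Pi.add_apply, indicator_of_mem hz]; ring
    · rw [norm_mul]
      exact mul_le_of_le_one_left (norm_nonneg _) (hχ1 n z)
  refine ⟨fun n z => χ n z * V n z, fun n => ⟨(hχ n).1.mul (hVs n), (hχ n).2.mul_right⟩,
    hconv hv.1, fun e => ?_⟩
  have h2 : Tendsto (fun n => eLpNorm (fun z => V n z * fderiv ℝ (χ n) z e) 2 (halfMeasure N))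
      atTop (𝓝 0) := by
    have hK : Tendsto (fun n : ℕ => ENNReal.ofReal (|K| * ‖e‖ / ((n : ℝ) + 1)) *
        eLpNorm ((halfSpace N).indicator v) 2 volume) atTop (𝓝 0) := by
      have h3 : Tendsto (fun n : ℕ => |K| * ‖e‖ / ((n : ℝ) + 1)) atTop (𝓝 0) := by
        have := (tendsto_one_div_add_atTop_nhds_zero_nat (𝕜 := ℝ)).const_mul (|K| * ‖e‖)
        simpa [div_eq_mul_inv] using this
      have h4 := (ENNReal.continuous_ofReal.tendsto 0).comp h3
      rw [ENNReal.ofReal_zero] at h4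
      simpa using ENNReal.Tendsto.mul_const h4 (Or.inr hvx.eLpNorm_ne_top)
    refine tendsto_of_tendsto_of_tendsto_of_le_of_le tendsto_const_nhds hK (fun _ => zero_le)
      fun n => ?_
    refine (eLpNorm_le_mul_eLpNorm_of_ae_le_mul (Eventually.of_forall fun z => ?_) 2).trans
      (mul_le_mul' le_rfl ((hle (V n)).trans (eLpNorm_mollify_le hvx.aestronglyMeasurable)))
    rw [norm_mul, mul_comm]
    refine mul_le_mul_of_nonneg_right ((hχd n z e).trans ?_) (norm_nonneg _)
    gcongr
    exact le_abs_self K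
  refine tendsto_of_tendsto_of_tendsto_of_le_of_le tendsto_const_nhds
    (by simpa using (hconv (memLp_dot hG.1 e)).add h2) (fun _ => zero_le) fun n => ?_
  have hGx := hext (memLp_dot hG.1 e)
  have hM : Continuous (mollify n ((halfSpace N).indicator fun z => dot (weakGrad v z) e)) :=
    (contDiff_mollify (hGx.locallyIntegrable (by norm_num))).continuous
  refine le_trans (le_of_eq (eLpNorm_congr_ae ?_)) (eLpNorm_add_le
    (((hχ n).1.continuous.mul hM).aestronglyMeasurable.sub (memLp_dot hG.1 e).aestronglyMeasurable)
    ((hVs n).continuous.mul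
      (continuous_fderiv_apply_of_smooth (hχ n).1 e)).aestronglyMeasurable (by norm_num))
  filter_upwards [ae_restrict_mem hSm] with z hz
  have h5 := (((hχ n).1.differentiable (by simp) z).hasFDerivAt.mul
    ((hVs n).differentiable (by simp) z).hasFDerivAt).fderiv
  have h6 := fderiv_mollify (n := n) hvl hG e hz
  change fderiv ℝ (fun z => χ n z * V n z) z = _ at h5
  rw [h5]
  simp only [_root_.add_apply, _root_.smul_apply, smul_eq_mul, Pi.add_apply]
  rw [h6]; ring

/-- Trace inequality in `L²` for smooth functions. -/
lemma eLpNorm_trace_two_le {N : ℕ} {φ : Amb N → ℝ} (hφ : ContDiff ℝ ∞ φ)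
    (hφc : HasCompactSupport φ) :
    eLpNorm (fun y => φ (0, y)) 2 volume ≤ eLpNorm φ 2 (halfMeasure N) +
      ∑ i, eLpNorm (fun z => fderiv ℝ φ z (stdVec i)) 2 (halfMeasure N) := by
  set a := eLpNorm φ 2 (halfMeasure N) with ha
  set b := ∑ i, eLpNorm (fun z => fderiv ℝ φ z (stdVec i)) 2 (halfMeasure N) with hb
  have h := lintegral_trace_rpow_le (s := 2) (by norm_num) hφ hφc
  have e1 : ((2 : ℝ≥0) : ℝ) - 1 = 1 := by norm_num
  rw [e1] at h
  simp only [NNReal.coe_ofNat, ENNReal.rpow_one, ENNReal.coe_ofNat] at h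
  have e2 : (∫⁻ z, ‖φ z‖ₑ ^ (2 : ℝ) ∂(halfMeasure N)) ^ (1 / (2 : ℝ)) = a := by
    rw [ha, eLpNorm_eq_lintegral_rpow_enorm_toReal two_ne_zero ENNReal.ofNat_ne_top,
      ENNReal.toReal_ofNat]
  rw [e2] at h
  have h2 : ∫⁻ y, ‖φ ((0 : ℝ), y)‖ₑ ^ (2 : ℝ) ≤ (a + b) ^ (2 : ℝ) := by
    calc _ ≤ 2 * (a * eLpNorm (fderiv ℝ φ) 2 (halfMeasure N)) := h
      _ ≤ 2 * (a * b) := by gcongr; exact eLpNorm_fderiv_le_sum hφ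
      _ ≤ 2 * (a * b) + (a ^ 2 + b ^ 2) := le_self_add
      _ = (a + b) ^ (2 : ℝ) := by rw [ENNReal.rpow_ofNat]; ring
  rw [eLpNorm_eq_lintegral_rpow_enorm_toReal two_ne_zero ENNReal.ofNat_ne_top,
    ENNReal.toReal_ofNat]
  refine (ENNReal.rpow_le_rpow h2 (by norm_num)).trans (le_of_eq ?_)
  rw [← ENNReal.rpow_mul]; norm_num

/-- Trace theorem: every function in `H¹` has a trace. -/
lemma MemH1.exists_isTrace {N : ℕ} {v : Amb N → ℝ} (hv : MemH1 v) : ∃ u, IsTrace v u := by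
  obtain ⟨φ, hφ, h0, h1⟩ := hv.exists_smooth_approx
  have hG := hv.isWeakGrad.1
  set T : ℕ → Bdry N → ℝ := fun n y => φ n (0, y) with hT
  have hTc : ∀ n, Continuous (T n) := fun n => (hφ n).1.continuous.comp (by fun_prop)
  have hTL : ∀ n, MemLp (T n) 2 volume := fun n => by
    refine (hTc n).memLp_of_hasCompactSupport ?_
    obtain ⟨R, hR⟩ := (hφ n).2.isCompact.isBounded.subset_closedBall (0 : Amb N)
    refine HasCompactSupport.intro (isCompact_closedBall (0 : Bdry N) R) fun y hy => ?_
    refine image_eq_zero_of_notMem_tsupport (f := φ n) fun h => hy ?_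
    have := mem_closedBall_zero_iff.1 (hR h)
    rw [Prod.norm_def] at this
    exact mem_closedBall_zero_iff.2 ((le_max_right _ _).trans this)
  set d : ℕ → ℝ≥0∞ := fun n => eLpNorm (fun z => φ n z - v z) 2 (halfMeasure N) +
    ∑ i, eLpNorm (fun z => fderiv ℝ (φ n) z (stdVec i) - dot (weakGrad v z) (stdVec i)) 2
      (halfMeasure N) with hd
  have hdlim : Tendsto d atTop (𝓝 0) := by
    have := h0.add (tendsto_finsetSum Finset.univ fun i _ => h1 (stdVec i))
    rwa [Finset.sum_const_zero, add_zero] at this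
  have hsub : ∀ {F F' f : Amb N → ℝ}, AEStronglyMeasurable F (halfMeasure N) →
      AEStronglyMeasurable F' (halfMeasure N) → AEStronglyMeasurable f (halfMeasure N) →
      eLpNorm (fun z => F z - F' z) 2 (halfMeasure N) ≤
        eLpNorm (fun z => F z - f z) 2 (halfMeasure N) +
          eLpNorm (fun z => F' z - f z) 2 (halfMeasure N) := fun {F F' f} hF hF' hf => by
    refine le_trans (le_of_eq ?_) (eLpNorm_sub_le (hF.sub hf) (hF'.sub hf) (by norm_num))
    congr 1; ext z; simp
  have hcau : ∀ n k, eLpNorm (fun y => T n y - T k y) 2 volume ≤ d n + d k := fun n k => by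
    refine (eLpNorm_trace_two_le ((hφ n).1.sub (hφ k).1) ((hφ n).2.sub (hφ k).2)).trans ?_
    simp only [hd]
    rw [add_add_add_comm, ← Finset.sum_add_distrib]
    refine add_le_add (hsub (hφ n).1.continuous.aestronglyMeasurable
      (hφ k).1.continuous.aestronglyMeasurable hv.1.aestronglyMeasurable)
      (Finset.sum_le_sum fun i _ => ?_)
    refine le_trans (le_of_eq ?_) (hsub
      (continuous_fderiv_apply_of_smooth (hφ n).1 (stdVec i)).aestronglyMeasurable
      (continuous_fderiv_apply_of_smooth (hφ k).1 (stdVec i)).aestronglyMeasurable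
      (memLp_dot hG (stdVec i)).aestronglyMeasurable)
    congr 1; ext z
    rw [show (fun z => φ n z - φ k z) = φ n - φ k from rfl,
      fderiv_sub ((hφ n).1.differentiable (by simp) _) ((hφ k).1.differentiable (by simp) _)]
    rfl
  have hC : CauchySeq fun n => (hTL n).toLp (T n) := by
    rw [EMetric.cauchySeq_iff]
    intro ε hε
    have hε2 : 0 < ε / 2 := ENNReal.half_pos hε.ne'
    obtain ⟨n₀, hn₀⟩ := eventually_atTop.1 (hdlim.eventually_lt_const hε2)
    refine ⟨n₀, fun n hn k hk => ?_⟩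
    rw [Lp.edist_toLp_toLp]
    calc _ ≤ d n + d k := hcau n k
      _ < ε / 2 + ε / 2 := ENNReal.add_lt_add (hn₀ n hn) (hn₀ k hk)
      _ = ε := ENNReal.add_halves ε
  obtain ⟨U, hU⟩ := cauchySeq_tendsto_of_complete hC
  refine ⟨U, Lp.memLp U, φ, hφ, h0, h1, ?_⟩
  have := (Lp.tendsto_Lp_iff_tendsto_eLpNorm'' T hTL U (Lp.memLp U)).1 (by simpa using hU)
  exact this

lemma MemH1.isTrace_trace {N : ℕ} {v : Amb N → ℝ} (hv : MemH1 v) : IsTrace v (trace v) := by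
  rw [trace, dif_pos hv.exists_isTrace]
  exact hv.exists_isTrace.choose_spec

lemma MemH1.memLp_trace {N : ℕ} (hN : 2 ≤ N) {s : ℝ} (hs : s = 2 * N / (N - 1)) {v : Amb N → ℝ}
    (hv : MemH1 v) : MemLp (trace v) (ENNReal.ofReal s) volume := by
  have hN' : (2 : ℝ) ≤ N := by exact_mod_cast hN
  have hs0 : 0 ≤ s := hs ▸ div_nonneg (by linarith) (by linarith)
  lift s to ℝ≥0 using hs0
  obtain ⟨C, hC⟩ := exists_trace_bound N hN hs
  refine ⟨hv.isTrace_trace.1.aestronglyMeasurable, ?_⟩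
  rw [ENNReal.ofReal_coe_nnreal]
  exact (hC v _ hv hv.isTrace_trace).trans_lt
    (ENNReal.mul_lt_top ENNReal.coe_lt_top ENNReal.ofReal_lt_top)

end Hartree

open Hartree in
theorem proposition6p3 (N : ℕ) (hN : 2 ≤ N)
    -- the nonlinearity
    (f : ℝ → ℝ) (hf_C1 : ContDiff ℝ 1 f)
    (hf_nonneg : ∀ t, 0 ≤ t → 0 ≤ f t) (hf_neg : ∀ t, t < 0 → f t = 0)
    (θ : ℝ) (hθ_lower : 2 < θ) (hθ_upper : θ < 2 * (N : ℝ) / ((N : ℝ) - 1))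
    (hf1 : Tendsto (fun t => |f t| / t) (𝓝[≠] 0) (𝓝 0))
    (hf2 : Tendsto (fun t => f t / t ^ (θ - 1)) atTop (𝓝 0))
    (hf3 : MonotoneOn (fun t => f t / t) (Ioi 0))
    -- the mass and the potential
    (m V₀ Vinf : ℝ) (hV₀_pos : 0 < V₀) (hV₀_lt : V₀ < m)
    (V : Bdry N → ℝ) (hV_cont : Continuous V) (hV1 : ∀ y, 0 ≤ V y + V₀)
    (hV2 : Tendsto V (cocompact (Bdry N)) (𝓝 Vinf)) (hVinf : 0 < Vinf)
    (hV3 : ∀ y, V y ≤ Vinf) (hV3' : ∃ y, V y ≠ Vinf)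
    -- the convolution kernel
    (r : ℝ) (hr : (N : ℝ) / ((N : ℝ) * (2 - θ) + θ) < r)
    (W W₁ W₂ : Bdry N → ℝ) (hW : W =ᵐ[volume] W₁ + W₂)
    (hW₁ : MemLp W₁ (ENNReal.ofReal r) volume) (hW₂ : MemLp W₂ ∞ volume)
    (hW_nonneg : 0 ≤ᵐ[volume] W)
    (hW_radial : ∃ ρ : ℝ → ℝ, W =ᵐ[volume] fun y => ρ ‖y‖)
    -- the weak solution
    (v : Amb N → ℝ) (hv : IsWeakSolution m V W f v) :
    (∀ p : ℝ≥0∞, 2 ≤ p → MemLp (trace v) p volume) ∧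
      MemLp v ∞ (halfMeasure N) := by
  obtain ⟨hv1, heq⟩ := hv
  have hf := hf_C1.continuous
  have hu := hv1.isTrace_trace
  have hu2 := hu.1
  have hus := hv1.memLp_trace hN rfl
  set u := trace v with hu_def
  have hWm : AEStronglyMeasurable W volume :=
    (hW₁.aestronglyMeasurable.add hW₂.aestronglyMeasurable).congr hW.symm
  obtain ⟨c, q, g, hc, hq, hg, hbound⟩ := exists_hartree_coefficient hN hf hf_neg rfl hθ_lower
    hθ_upper hf1 hf2 hr hW hW₁ hW₂ hu2 hus
  have hBm : AEStronglyMeasurable (fun y => hartree W f u y * f (u y)) volume :=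
    (aestronglyMeasurable_hartree hf hWm hu2.aestronglyMeasurable).mul
      (hf.comp_aestronglyMeasurable hu2.aestronglyMeasurable)
  have hVb : ∀ y, |V y| ≤ Vinf + V₀ := fun y =>
    abs_le.2 ⟨by linarith [hV1 y], by linarith [hV3 y]⟩
  have heq' : ∀ φ : Amb N → ℝ, MemH1 φ →
      ∫ z, (dot (weakGrad v z) (weakGrad φ z) + m ^ 2 * v z * φ z) ∂(halfMeasure N) =
        ∫ y, (hartree W f u y * f (u y) - V y * u y) * trace φ y := fun φ hφ => by
    have hw2 := hφ.isTrace_trace.1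
    have i1 := integrable_coefficient_mul hN rfl hq hu2 hus hw2 (hφ.memLp_trace hN rfl) hBm hg
      hbound
    have i2 : Integrable (fun y => V y * u y * trace φ y) volume := by
      have := (hu2.integrable_mul hw2).bdd_mul (c := Vinf + V₀) hV_cont.aestronglyMeasurable
        (Eventually.of_forall hVb)
      refine this.congr (Eventually.of_forall fun y => ?_)
      simp only [Pi.mul_apply]; ring
    have h := heq φ hφ
    simp only [sub_mul]
    rw [integral_sub i1 i2]
    linarith
  obtain ⟨M, hMu, hMv⟩ := exists_bound_of_weak_equation (c := c + (Vinf + V₀)) hN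
    (hV₀_pos.trans hV₀_lt) hv1 hu heq' (by linarith) hq hg (by
      filter_upwards [hbound] with y hy
      calc |hartree W f u y * f (u y) - V y * u y|
          ≤ |hartree W f u y * f (u y)| + |V y| * |u y| := by
            rw [← abs_mul]; exact abs_sub _ _
        _ ≤ (c + |g y|) * |u y| + (Vinf + V₀) * |u y| := by gcongr; exact hVb y
        _ = _ := by ring)
  exact ⟨fun p hp => memLp_of_bounded hu2 hMu hp,
    memLp_top_of_bound hv1.1.aestronglyMeasurable M hMv⟩
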